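/- Let $\mathcal C$ be a symmetric monoidal model category, i.e. a closed symmetric monoidal category with a model structure such that $\otimes$ satisfies the pushout-product axiom and such that, for a cofibrant replacement $q\colon Q\to\mathbf 1$ of the unit, $q\otimes X$ is a weak equivalence for every cofibrant $X$. Assume that the unit $\mathbf 1$ is cofibrant and that the underlying category of $\mathcal C$ is additive (preadditive with finite coproducts). Then $\mathcal C$ is an additive model category. Moreover, every $\mathcal C$-model category is an additive model category; in particular its underlying category is additive. Here a $\mathcal C$-model category is a model category $\mathcal M$ with a coherently associative and unital right action $\otimes\colon\mathcal M\times\mathcal C\to\mathcal M$, cotensors $F(c,Z)\in\mathcal M$ and enriched hom-objects $\underline{\mathcal M}(X,Z)\in\mathcal C$, with natural isomorphisms $\mathcal M(X\otimes c,Z)\cong\mathcal M(X,F(c,Z))\cong\mathcal C(c,\underline{\mathcal M}(X,Z))$, such that the action satisfies the pushout-product axiom and $X\otimes q\colon X\otimes Q\to X\otimes\mathbf 1$ is a weak equivalence for every cofibrant $X\in\mathcal M$ and every cofibrant replacement $q\colon Q\to\mathbf 1$ of the unit of $\mathcal C$. A cosimplicial resolution in a model category $\mathcal M$ is a Reedy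 cofibrant cosimplicial object all of whose coface and codegeneracy maps are weak equivalences. If $\mathcal M$ has an additive underlying category and $\mathcal I$ is a small full subcategory of the category $\mathcal M_{cof}$ of cofibrant objects, an additive cosimplicial resolution on $\mathcal I$ is an additive functor $\Gamma$ from $\mathcal I$ to cosimplicial objects of $\mathcal M$ with values in cosimplicial resolutions, together with a natural weak equivalence $\Gamma(X)^0\to X$. The model category $\mathcal M$ is additive if its underlying category is additive and, for every small full subcategory $\mathcal I\subseteq\mathcal M_{cof}$, (a) there is an additive cosimplicial resolution on $\mathcal I$, and (b) the category of additive cosimplicial resolutions on $\mathcal I$, whose maps are the natural weak equivalences $\Gamma\to\Gamma'$ compatible with the maps to $X$, is connected (any two objects are joined by a zig-zag). -/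

import Mathlib

open CategoryTheory Limits HomotopicalAlgebra MonoidalCategory Opposite
open scoped Simplicial

universe v v₁ v₂ v₃ u u₁ u₂ u₃

namespace AdditiveModel

noncomputable section

/-! ### Additive categories -/

/-- A category is additive if it admits a preadditive structure and has finite coproducts. -/
structure IsAdditiveCategory (C : Type u) [Category.{v} C] : Prop where
  nonempty_preadditive : Nonempty (Preadditive C)
  hasFiniteCoproducts : HasFiniteCoproducts C

instance (M : Type u) [Category.{v} M] [Preadditive M] : Preadditive (CosimplicialObject M) :=
  inferInstanceAs (Preadditive (SimplexCategory ⥤ M))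

/-! ### Latching objects and cosimplicial resolutions -/

/-- The objects of the `n`-th latching category: injective maps `⦋m⦌ ⟶ ⦋n⦌` of `Δ` other than
the identity. -/
def latchingProperty (n : ℕ) : ObjectProperty (Over (SimplexCategory.mk n)) :=
  fun f => Mono f.hom ∧ ¬ IsIso f.hom

/-- The `n`-th latching category of `Δ`. A morphism over `⦋n⦌` between injective maps is itself
injective, so this is a full subcategory of the category of objects over `⦋n⦌`. -/
abbrev LatchingCategory (n : ℕ) : Type := (latchingProperty n).FullSubcategory

theorem finite_simplexCategory_hom (a b : SimplexCategory) : Finite (a ⟶ b) :=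
  Finite.of_injective (fun f : a ⟶ b => (f.toOrderHom : Fin (a.len + 1) → Fin (b.len + 1)))
    (fun f g h => SimplexCategory.Hom.ext f g (OrderHom.ext _ _ h))

theorem finite_latchingCategory (n : ℕ) : Finite (LatchingCategory n) := by
  have (m : Fin (n + 1)) : Finite (SimplexCategory.mk m.1 ⟶ SimplexCategory.mk n) :=
    finite_simplexCategory_hom _ _
  refine Finite.of_surjective
    (α := {x : (Σ m : Fin (n + 1), (SimplexCategory.mk m.1 ⟶ SimplexCategory.mk n)) //
      latchingProperty n (Over.mk x.2)})
    (fun x => ⟨Over.mk x.1.2, x.2⟩) ?_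
  rintro ⟨⟨a, ⟨⟨⟩⟩, f⟩, hf⟩
  have hmono : Mono f := hf.1
  have hle := SimplexCategory.len_le_of_mono f
  exact ⟨⟨⟨⟨a.len, Nat.lt_succ_of_le hle⟩, f⟩, hf⟩, rfl⟩

instance (n : ℕ) : FinCategory (LatchingCategory n) where
  fintypeObj := @Fintype.ofFinite _ (finite_latchingCategory n)
  fintypeHom a b := by
    have : Finite (a ⟶ b) := by
      have := finite_simplexCategory_hom a.obj.left b.obj.left
      refine Finite.of_injective (fun f : a ⟶ b => f.hom.left) ?_
      intro f g h
      exact ObjectProperty.hom_ext _ (Over.OverMorphism.ext h)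
    exact Fintype.ofFinite _

section

variable {M : Type u} [Category.{v} M]

/-- The diagram `([m] ⟶ [n]) ↦ Xᵐ` whose colimit is the `n`-th latching object of `X`. -/
def latchingDiagram (X : CosimplicialObject M) (n : ℕ) : LatchingCategory n ⥤ M :=
  (latchingProperty n).ι ⋙ Over.forget _ ⋙ (X : SimplexCategory ⥤ M)

/-- The canonical cocone with point `Xⁿ` over the latching diagram. -/
def latchingCocone (X : CosimplicialObject M) (n : ℕ) : Cocone (latchingDiagram X n) where
  pt := X.obj (SimplexCategory.mk n)
  ι :=
    { app := fun f => X.map f.obj.hom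
      naturality := fun f g φ => by
        have h : X.map φ.hom.left ≫ X.map g.obj.hom = X.map f.obj.hom := by
          rw [← X.map_comp, Over.w]
        exact h.trans (Category.comp_id _).symm }

/-- The `n`-th latching object of a cosimplicial object. -/
def latchingObj [HasFiniteColimits M] (X : CosimplicialObject M) (n : ℕ) : M :=
  colimit (latchingDiagram X n)

/-- The `n`-th latching map of a cosimplicial object. -/
def latchingMap [HasFiniteColimits M] (X : CosimplicialObject M) (n : ℕ) :
    latchingObj X n ⟶ X.obj (SimplexCategory.mk n) :=
  colimit.desc (latchingDiagram X n) (latchingCocone X n)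

/-- Reedy cofibrant cosimplicial objects: all latching maps are cofibrations. -/
def IsReedyCofibrant [ModelCategory M] (X : CosimplicialObject M) : Prop :=
  ∀ n : ℕ, Cofibration (latchingMap X n)

/-- A cosimplicial resolution is a Reedy cofibrant cosimplicial object all of whose coface and
codegeneracy maps are weak equivalences. -/
structure IsCosimplicialResolution [ModelCategory M] (X : CosimplicialObject M) : Prop where
  reedyCofibrant : IsReedyCofibrant X
  weakEquivalence_δ : ∀ (n : ℕ) (i : Fin (n + 2)), WeakEquivalence (X.δ i)
  weakEquivalence_σ : ∀ (n : ℕ) (i : Fin (n + 1)), WeakEquivalence (X.σ i)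

end

/-! ### Additive cosimplicial resolutions and additive model categories -/

/-- An additive cosimplicial resolution on the full subcategory of `M` with objects `I`: an
additive functor to cosimplicial objects with values in cosimplicial resolutions, together with a
natural weak equivalence `Γ(X)⁰ ⟶ X`. -/
structure AdditiveCosimplicialResolution {M : Type u} [Category.{v} M] [ModelCategory M]
    [Preadditive M] (I : ObjectProperty M) where
  Γ : I.FullSubcategory ⥤ CosimplicialObject M
  additive : Γ.Additive
  isCosimplicialResolution : ∀ X : I.FullSubcategory, IsCosimplicialResolution (Γ.obj X)
  aug : ∀ X : I.FullSubcategory, (Γ.obj X).obj (SimplexCategory.mk 0) ⟶ X.obj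
  aug_naturality : ∀ {X Y : I.FullSubcategory} (f : X ⟶ Y),
    (Γ.map f).app (SimplexCategory.mk 0) ≫ aug Y = aug X ≫ f.hom
  weakEquivalence_aug : ∀ X : I.FullSubcategory, WeakEquivalence (aug X)

namespace AdditiveCosimplicialResolution

variable {M : Type u} [Category.{v} M] [ModelCategory M] [Preadditive M] {I : ObjectProperty M}

/-- A map of additive cosimplicial resolutions which is a weak equivalence: a natural
transformation over the identity of `I` consisting of (levelwise) weak equivalences. -/
@[ext]
structure Hom (A B : AdditiveCosimplicialResolution I) where
  τ : A.Γ ⟶ B.Γ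
  τ_aug : ∀ X : I.FullSubcategory,
    (τ.app X).app (SimplexCategory.mk 0) ≫ B.aug X = A.aug X
  weakEquivalence_τ : ∀ (X : I.FullSubcategory) (n : SimplexCategory),
    WeakEquivalence ((τ.app X).app n)

/-- The category of additive cosimplicial resolutions on `I` and natural weak equivalences. -/
instance : Category (AdditiveCosimplicialResolution I) where
  Hom A B := Hom A B
  id A :=
    { τ := 𝟙 A.Γ
      τ_aug := fun X => Category.id_comp (A.aug X)
      weakEquivalence_τ := fun X n =>
        inferInstanceAs (WeakEquivalence (𝟙 ((A.Γ.obj X).obj n))) }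
  comp {A B C} f g :=
    { τ := f.τ ≫ g.τ
      τ_aug := fun X => by
        rw [← f.τ_aug X, ← g.τ_aug X]
        exact Category.assoc _ _ _
      weakEquivalence_τ := fun X n => by
        have := f.weakEquivalence_τ X n
        have := g.weakEquivalence_τ X n
        exact inferInstanceAs (WeakEquivalence ((f.τ.app X).app n ≫ (g.τ.app X).app n)) }
  id_comp f := Hom.ext (Category.id_comp f.τ)
  comp_id f := Hom.ext (Category.comp_id f.τ)
  assoc f g h := Hom.ext (Category.assoc f.τ g.τ h.τ)

end AdditiveCosimplicialResolution

/-- A model category `M` is additive if its underlying category is additive and, for every small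
full subcategory `I` of the category of cofibrant objects, (a) there is an additive cosimplicial
resolution on `I`, and (b) the category of additive cosimplicial resolutions on `I` is connected.
(The preadditive structure of an additive category is unique.) -/
def IsAdditiveModelCategory (M : Type u) [Category.{v} M] [ModelCategory M] : Prop :=
  ∃ _ : Preadditive M, HasFiniteCoproducts M ∧
    ∀ I : ObjectProperty M, ObjectProperty.Small.{v} I → I ≤ cofibrantObjects M →
      Nonempty (AdditiveCosimplicialResolution I) ∧
        IsConnected (AdditiveCosimplicialResolution I)

/-! ### Symmetric monoidal model categories and `C`-model categories -/

/-- The pushout-product axiom (the analogue of SM7) for a bifunctor between model categories: for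
cofibrations `i : A ⟶ B` and `j : X ⟶ Y`, the map
`F(B, X) ⨿_{F(A, X)} F(A, Y) ⟶ F(B, Y)` is a cofibration, and is a weak equivalence as soon as
`i` or `j` is one. -/
structure PushoutProductAxiom {C₁ : Type u₁} [Category.{v₁} C₁] [ModelCategory C₁]
    {C₂ : Type u₂} [Category.{v₂} C₂] [ModelCategory C₂]
    {C₃ : Type u₃} [Category.{v₃} C₃] [ModelCategory C₃] (F : C₁ ⥤ C₂ ⥤ C₃) : Prop where
  cofibration : ∀ {A B : C₁} {X Y : C₂} (i : A ⟶ B) (j : X ⟶ Y),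
    Cofibration i → Cofibration j →
      Cofibration (Functor.PushoutObjObj.ofHasPushout F i j).ι
  weakEquivalence : ∀ {A B : C₁} {X Y : C₂} (i : A ⟶ B) (j : X ⟶ Y),
    Cofibration i → Cofibration j → (WeakEquivalence i ∨ WeakEquivalence j) →
      WeakEquivalence (Functor.PushoutObjObj.ofHasPushout F i j).ι

/-- A closed symmetric monoidal category with a model structure is a symmetric monoidal model
category if the tensor product satisfies the pushout-product axiom and if, for a cofibrant
replacement `q : Q ⟶ 𝟙` of the unit, `q ⊗ X` is a weak equivalence for all cofibrant `X`. -/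
class IsSymmetricMonoidalModelCategory (C : Type u) [Category.{v} C] [ModelCategory C]
    [MonoidalCategory C] [SymmetricCategory C] [MonoidalClosed C] : Prop where
  pushoutProduct : PushoutProductAxiom (curriedTensor C)
  unit : ∀ {Q : C} (q : Q ⟶ 𝟙_ C), IsCofibrant Q → Fibration q → WeakEquivalence q →
    ∀ X : C, IsCofibrant X → WeakEquivalence (q ▷ X)

/-- A closed `C`-module category: a category `M` with tensors `X ⊗ c` forming a (coherently
associative and unital) right action of `C` on `M`, cotensors `F(c, Z)`, enriched hom-objects
`Map(X, Z)` in `C`, and natural isomorphisms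
`M(X ⊗ c, Z) ≅ M(X, F(c, Z))` and `M(X ⊗ c, Z) ≅ C(c, Map(X, Z))`. -/
class ClosedModuleCategory (C : Type u₁) [Category.{v₁} C] [MonoidalCategory C]
    (M : Type u₂) [Category.{v₂} M] extends MonoidalRightAction C M where
  cotensor : Cᵒᵖ ⥤ M ⥤ M
  enrichedHom : Mᵒᵖ ⥤ M ⥤ C
  tensorCotensorAdj : MonoidalRightAction.curriedAction C M ⊣₂ cotensor
  tensorHomAdj : (MonoidalRightAction.curriedAction C M).flip ⊣₂ enrichedHom

open scoped MonoidalRightAction in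
/-- A closed `C`-module category with a model structure is a `C`-model category if the action
`M × C ⟶ M` satisfies the pushout-product axiom and if, for a cofibrant replacement `q : Q ⟶ 𝟙`
of the unit of `C`, `X ⊗ q` is a weak equivalence for all cofibrant `X` in `M`. -/
class IsCModelCategory (C : Type u₁) [Category.{v₁} C] [ModelCategory C] [MonoidalCategory C]
    (M : Type u₂) [Category.{v₂} M] [ModelCategory M] [ClosedModuleCategory C M] : Prop where
  pushoutProduct : PushoutProductAxiom (MonoidalRightAction.curriedAction C M).flip
  unit : ∀ {Q : C} (q : Q ⟶ 𝟙_ C), IsCofibrant Q → Fibration q → WeakEquivalence q →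
    ∀ X : M, IsCofibrant X → WeakEquivalence (X ⊴ᵣ q)

end

end AdditiveModel

/-!
Write `T(X, c)` for the tensor `X ⊗ c` of `X : M` by `c : C`, where `M` is a `C`-model category or
`C` itself. It satisfies the pushout-product axiom, preserves finite colimits in each variable, as
it has right adjoints, and `T(X, 𝟙) ≅ X`. The category `M` is preadditive because
`M(X, Z) ≅ M(X ⊗ 𝟙, Z) ≅ C(𝟙, Map(X, Z))`.

The unit has a cosimplicial resolution `A` in `C` whose augmentations `Aⁿ ⟶ 𝟙` have sections which
are trivial cofibrations (`exists_cosimplicial_resolution`). It is constructed from the additive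
structure alone, by applying the Dold-Kan correspondence in the opposite category to the cochain
complex obtained by embedding repeatedly the suspensions of `𝟙` into cones. As simplicial abelian
groups satisfy the Kan condition, its Reedy cofibrancy reduces to a lifting property of this complex
(`isReedyCofibrant_coΓ`); and `Aⁿ` is the direct sum of `𝟙` and cones.

For `X` cofibrant, the `T(X, Aⁿ)` form a cosimplicial resolution of `X`, which is additive in `X`.
Given any additive cosimplicial resolution `Γ`, the diagonals `T(Γ(X)ⁿ, Aⁿ)` form another one, and
there are natural weak equivalences `Γ(X)ⁿ ← T(Γ(X)ⁿ, Aⁿ) → T(X, Aⁿ)`. Hence any two additive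
cosimplicial resolutions are joined by a zigzag (`isConnected_additiveCosimplicialResolution`). The
main point is that the diagonal is Reedy cofibrant (`isReedyCofibrant_diagonal`): a map from
`T(Pⁿ, Qⁿ)` is extended from the boundary by going through the pairs of faces of the `n`-simplex one
at a time, and each step is an instance of the pushout-product axiom for latching maps.

Cosimplicial objects are written as functors `SimplexCategory ⥤ M`, and the category `M` is given
explicitly to the predicates on `CosimplicialObject M`, which is not a reducible synonym.
-/

namespace AdditiveModel

/-! ### Faces and latching objects -/

section Latching

variable {M : Type u} [Category.{v} M] [HasFiniteColimits M]

/-- The map to the `n`-th latching object given by a proper face of `⦋n⦌`. -/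
noncomputable def latchingι (X : SimplexCategory ⥤ M) {n : ℕ} {c : SimplexCategory} (f : c ⟶ ⦋n⦌)
    (hf : Mono f) (hf' : ¬ IsIso f) : X.obj c ⟶ latchingObj (M := M) X n :=
  colimit.ι (latchingDiagram X n) ⟨Over.mk f, hf, hf'⟩

theorem map_latchingι (X : SimplexCategory ⥤ M) {n : ℕ} {c c' : SimplexCategory} (h : c ⟶ c')
    (f : c' ⟶ ⦋n⦌) (hf : Mono f) (hf' : ¬ IsIso f) (hh : Mono (h ≫ f)) (hh' : ¬ IsIso (h ≫ f)) :
    X.map h ≫ latchingι X f hf hf' = latchingι X (h ≫ f) hh hh' :=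
  colimit.w (latchingDiagram X n) (ObjectProperty.homMk (Over.homMk h rfl :
    Over.mk (h ≫ f) ⟶ Over.mk f) : (⟨_, hh, hh'⟩ : LatchingCategory n) ⟶ ⟨_, hf, hf'⟩)

theorem latchingι_latchingMap (X : SimplexCategory ⥤ M) {n : ℕ} {c : SimplexCategory}
    (f : c ⟶ ⦋n⦌) (hf : Mono f) (hf' : ¬ IsIso f) :
    latchingι X f hf hf' ≫ latchingMap (M := M) X n = X.map f :=
  colimit.ι_desc _ _

/-- The colimit cocone over the image of a latching diagram by a functor `G` which preserves finite
colimits, in terms of families of maps indexed by proper faces. -/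
theorem exists_desc_map_latchingObj {N : Type u₁} [Category.{v₁} N] (X : SimplexCategory ⥤ M)
    (n : ℕ) (G : M ⥤ N) [PreservesFiniteColimits G] {E : N}
    (u : ∀ ⦃c : SimplexCategory⦄ (f : c ⟶ ⦋n⦌), Mono f → ¬ IsIso f → (G.obj (X.obj c) ⟶ E))
    (hu : ∀ ⦃c c' : SimplexCategory⦄ (h : c ⟶ c') (f : c' ⟶ ⦋n⦌) (hf : Mono f) (hf' : ¬ IsIso f)
      (hh : Mono (h ≫ f)) (hh' : ¬ IsIso (h ≫ f)),
      G.map (X.map h) ≫ u f hf hf' = u (h ≫ f) hh hh') :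
    ∃ d : G.obj (latchingObj (M := M) X n) ⟶ E, ∀ ⦃c : SimplexCategory⦄ (f : c ⟶ ⦋n⦌)
      (hf : Mono f) (hf' : ¬ IsIso f), G.map (latchingι X f hf hf') ≫ d = u f hf hf' := by
  let s : Cocone (latchingDiagram (M := M) X n ⋙ G) :=
    { pt := E
      ι :=
        { app := fun f => u f.obj.hom f.property.1 f.property.2
          naturality := fun f g φ => by
            have hw : φ.hom.left ≫ g.obj.hom = f.obj.hom := Over.w φ.hom
            have h₁ : Mono (φ.hom.left ≫ g.obj.hom) := hw ▸ f.property.1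
            have h₂ : ¬ IsIso (φ.hom.left ≫ g.obj.hom) := hw ▸ f.property.2
            have := hu φ.hom.left g.obj.hom g.property.1 g.property.2 h₁ h₂
            refine this.trans (Eq.trans ?_ (Category.comp_id _).symm)
            congr 1 } }
  refine ⟨(isColimitOfPreserves G (colimit.isColimit _)).desc s, fun c f hf hf' => ?_⟩
  exact (isColimitOfPreserves G (colimit.isColimit (latchingDiagram (M := M) X n))).fac s
    ⟨Over.mk f, hf, hf'⟩

theorem map_latchingObj_hom_ext {N : Type u₁} [Category.{v₁} N] (X : SimplexCategory ⥤ M)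
    {n : ℕ} (G : M ⥤ N) [PreservesFiniteColimits G] {E : N}
    {d d' : G.obj (latchingObj (M := M) X n) ⟶ E}
    (h : ∀ ⦃c : SimplexCategory⦄ (f : c ⟶ ⦋n⦌) (hf : Mono f) (hf' : ¬ IsIso f),
      G.map (latchingι X f hf hf') ≫ d = G.map (latchingι X f hf hf') ≫ d') : d = d' :=
  (isColimitOfPreserves G (colimit.isColimit (latchingDiagram (M := M) X n))).hom_ext
    fun f => h f.obj.hom f.property.1 f.property.2

theorem latchingObj_hom_ext (X : SimplexCategory ⥤ M) {n : ℕ} {E : M}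
    {d d' : latchingObj (M := M) X n ⟶ E}
    (h : ∀ ⦃c : SimplexCategory⦄ (f : c ⟶ ⦋n⦌) (hf : Mono f) (hf' : ¬ IsIso f),
      latchingι X f hf hf' ≫ d = latchingι X f hf hf' ≫ d') : d = d' :=
  map_latchingObj_hom_ext X (𝟭 M) h

end Latching

/-! ### Lifting criteria -/

section Lifting

variable {M : Type u} [Category.{v} M] [ModelCategory M]

theorem cofibration_of_exists_lift {A B : M} (i : A ⟶ B)
    (h : ∀ {E S : M} (p : E ⟶ S), Fibration p → WeakEquivalence p →
      ∀ (x : A ⟶ E) (y : B ⟶ S), x ≫ p = i ≫ y → ∃ l : B ⟶ E, i ≫ l = x ∧ l ≫ p = y) :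
    Cofibration i := by
  rw [cofibration_iff, ← trivialFibrations_llp]
  intro E S p hp
  rw [mem_trivialFibrations_iff] at hp
  refine ⟨fun {x y} sq => ?_⟩
  obtain ⟨l, h₁, h₂⟩ := h p hp.1 hp.2 x y sq.w
  exact ⟨⟨⟨l, h₁, h₂⟩⟩⟩

theorem trivialCofibration_of_exists_lift {A B : M} (i : A ⟶ B)
    (h : ∀ {E S : M} (p : E ⟶ S), Fibration p →
      ∀ (x : A ⟶ E) (y : B ⟶ S), x ≫ p = i ≫ y → ∃ l : B ⟶ E, i ≫ l = x ∧ l ≫ p = y) :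
    Cofibration i ∧ WeakEquivalence i := by
  rw [← mem_trivialCofibrations_iff, ← fibrations_llp]
  intro E S p hp
  refine ⟨fun {x y} sq => ?_⟩
  obtain ⟨l, h₁, h₂⟩ := h p ⟨hp⟩ x y sq.w
  exact ⟨⟨⟨l, h₁, h₂⟩⟩⟩

theorem isCofibrant_of_exists_lift {A : M}
    (h : ∀ {E S : M} (p : E ⟶ S), Fibration p → WeakEquivalence p →
      ∀ y : A ⟶ S, ∃ l : A ⟶ E, l ≫ p = y) : IsCofibrant A := by
  rw [isCofibrant_iff]
  refine cofibration_of_exists_lift _ fun p hp hp' x y _ => ?_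
  obtain ⟨l, hl⟩ := h p hp hp' y
  exact ⟨l, initialIsInitial.hom_ext _ _, hl⟩

theorem exists_lift_of_isCofibrant {A : M} (hA : IsCofibrant A) {E S : M} (p : E ⟶ S)
    [Fibration p] [WeakEquivalence p] (y : A ⟶ S) : ∃ l : A ⟶ E, l ≫ p = y := by
  have : Cofibration (initial.to A) := (isCofibrant_iff A).1 hA
  have sq : CommSq (initial.to E) (initial.to A) p y := ⟨initialIsInitial.hom_ext _ _⟩
  exact ⟨sq.lift, sq.fac_right⟩

/-- The latching map is a cofibration as soon as compatible families of maps on the proper faces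
of `⦋n⦌` can be extended along trivial fibrations. -/
theorem cofibration_latchingMap_of_exists_lift (X : SimplexCategory ⥤ M) (n : ℕ)
    (H : ∀ {E S : M} (p : E ⟶ S), Fibration p → WeakEquivalence p →
      ∀ (u : ∀ ⦃c : SimplexCategory⦄ (f : c ⟶ ⦋n⦌), Mono f → ¬ IsIso f → (X.obj c ⟶ E))
        (v : X.obj ⦋n⦌ ⟶ S),
        (∀ ⦃c c' : SimplexCategory⦄ (h : c ⟶ c') (f : c' ⟶ ⦋n⦌) (hf : Mono f) (hf' : ¬ IsIso f)
          (hh : Mono (h ≫ f)) (hh' : ¬ IsIso (h ≫ f)),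
          X.map h ≫ u f hf hf' = u (h ≫ f) hh hh') →
        (∀ ⦃c : SimplexCategory⦄ (f : c ⟶ ⦋n⦌) (hf : Mono f) (hf' : ¬ IsIso f),
          u f hf hf' ≫ p = X.map f ≫ v) →
        ∃ l : X.obj ⦋n⦌ ⟶ E, l ≫ p = v ∧
          ∀ ⦃c : SimplexCategory⦄ (f : c ⟶ ⦋n⦌) (hf : Mono f) (hf' : ¬ IsIso f),
            X.map f ≫ l = u f hf hf') :
    Cofibration (latchingMap (M := M) X n) := by
  refine cofibration_of_exists_lift _ fun {E S} p hp hp' x y hxy => ?_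
  obtain ⟨l, hl, hl'⟩ := H p hp hp'
    (fun c f hf hf' => (latchingι X f hf hf' : X.obj c ⟶ _) ≫ x) y
    (fun c c' h f hf hf' hh hh' => by
      rw [← map_latchingι X h f hf hf' hh hh', Category.assoc])
    (fun c f hf hf' => by
      rw [Category.assoc, hxy, ← Category.assoc, latchingι_latchingMap])
  refine ⟨l, latchingObj_hom_ext X fun c f hf hf' => ?_, hl⟩
  rw [← Category.assoc, latchingι_latchingMap]
  exact hl' f hf hf'

end Lifting

/-! ### Extending families over lower sets of a finite thin category -/

section Extension

variable {K : Type u₁} [Category.{v₁} K] {M : Type u} [Category.{v} M]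

/-- Let `X` be a diagram indexed by a finite thin category over an object `S`, and assume that, at
each `x`, a compatible family of maps over `S` defined at the objects strictly below `x` extends
to `x`. Then any compatible family defined on a lower set extends to the whole category. -/
theorem exists_extension_of_lowerSet [Quiver.IsThin K] [Finite K] (X : K ⥤ M) {E S : M} (p : E ⟶ S)
    (b : ∀ k, X.obj k ⟶ S) (hb : ∀ {j k : K} (φ : j ⟶ k), X.map φ ≫ b k = b j)
    (deg : K → ℕ) (hdeg : ∀ {j k : K}, (j ⟶ k) → IsEmpty (k ⟶ j) → deg j < deg k)
    (hext : ∀ (x : K) (e : ∀ y : K, (y ⟶ x) → IsEmpty (x ⟶ y) → (X.obj y ⟶ E)),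
      (∀ (y z : K) (φ : y ⟶ z) (hy : y ⟶ x) (hy' : IsEmpty (x ⟶ y)) (hz : z ⟶ x)
        (hz' : IsEmpty (x ⟶ z)), X.map φ ≫ e z hz hz' = e y hy hy') →
      (∀ (y : K) (hy : y ⟶ x) (hy' : IsEmpty (x ⟶ y)), e y hy hy' ≫ p = b y) →
      ∃ l : X.obj x ⟶ E, l ≫ p = b x ∧
        ∀ (y : K) (hy : y ⟶ x) (hy' : IsEmpty (x ⟶ y)), X.map hy ≫ l = e y hy hy')
    (U : K → Prop) (hU : ∀ {j k : K}, (j ⟶ k) → U k → U j)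
    (e : ∀ k, U k → (X.obj k ⟶ E))
    (he : ∀ {j k : K} (φ : j ⟶ k) (hj : U j) (hk : U k), X.map φ ≫ e k hk = e j hj)
    (hep : ∀ k (hk : U k), e k hk ≫ p = b k) :
    ∃ e' : ∀ k, X.obj k ⟶ E, (∀ {j k : K} (φ : j ⟶ k), X.map φ ≫ e' k = e' j) ∧
      (∀ k, e' k ≫ p = b k) ∧ ∀ k (hk : U k), e' k = e k hk := by
  classical
  -- induction on the number of objects at which the family is not yet defined
  induction hN : {k | ¬ U k}.ncard using Nat.strong_induction_on generalizing U with
  | _ N ih =>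
  by_cases hall : ∀ k, U k
  · exact ⟨fun k => e k (hall k), fun φ => he φ _ _, fun k => hep k _, fun k _ => rfl⟩
  push Not at hall
  -- an object of minimal degree outside of `U`
  obtain ⟨x, hx, hmin⟩ : ∃ x, ¬ U x ∧ ∀ y, ¬ U y → deg x ≤ deg y := by
    obtain ⟨x, hx, hx'⟩ := WellFounded.has_min (measure deg).wf {k | ¬ U k} hall
    exact ⟨x, hx, fun y hy => not_lt.1 (hx' y hy)⟩
  have hlow : ∀ y, (y ⟶ x) → IsEmpty (x ⟶ y) → U y := fun y hy hy' => by
    by_contra h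
    exact absurd (hdeg hy hy') (not_lt.2 (hmin y h))
  obtain ⟨l, hl, hl'⟩ := hext x (fun y hy hy' => e y (hlow y hy hy'))
    (fun y z φ hy hy' hz hz' => he φ _ _) (fun y hy hy' => hep y _)
  have hlU : ∀ y (hy : y ⟶ x) (h : U y), X.map hy ≫ l = e y h := fun y hy h =>
    hl' y hy ⟨fun g => hx (hU g h)⟩
  let U' : K → Prop := fun k => U k ∨ Nonempty (k ⟶ x)
  let e₁ : ∀ k, U' k → (X.obj k ⟶ E) := fun k hk =>
    if h : U k then e k h else X.map (hk.resolve_left h).some ≫ l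
  have he₁ : ∀ k (hk : U' k) (h : U k), e₁ k hk = e k h := fun k hk h => dif_pos h
  have he₁' : ∀ k (hk : U' k) (φ : k ⟶ x), e₁ k hk = X.map φ ≫ l := fun k hk φ => by
    by_cases h : U k
    · rw [he₁ k hk h, hlU k φ h]
    · dsimp only [e₁]
      rw [dif_neg h]
      congr 2
      exact Subsingleton.elim _ _
  obtain ⟨e', h₁, h₂, h₃⟩ := ih ({k | ¬ U' k}.ncard) (by
      rw [← hN]
      exact Set.ncard_lt_ncard (Set.ssubset_iff_exists.2
        ⟨fun k hk h => hk (Or.inl h), x, hx, fun h => h (Or.inr ⟨𝟙 x⟩)⟩))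
    U' (fun φ hk => hk.imp (hU φ) (fun ⟨ψ⟩ => ⟨φ ≫ ψ⟩)) e₁
    (fun {j k} φ hj hk => by
      by_cases h : U k
      · rw [he₁ k hk h, he₁ j hj (hU φ h), he φ]
      · obtain ⟨ψ⟩ := hk.resolve_left h
        rw [he₁' k hk ψ, he₁' j hj (φ ≫ ψ), Functor.map_comp, Category.assoc])
    (fun k hk => by
      by_cases h : U k
      · rw [he₁ k hk h, hep]
      · obtain ⟨ψ⟩ := hk.resolve_left h
        rw [he₁' k hk ψ, Category.assoc, hl, hb]) rfl
  exact ⟨e', h₁, h₂, fun k hk => (h₃ k (Or.inl hk)).trans (he₁ k (Or.inl hk) hk)⟩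

end Extension

/-! ### Faces of a simplex -/

/-- The faces of the simplex `a`, including `a` itself: monomorphisms with target `a`. -/
structure Face (a : SimplexCategory) where
  /-- the source of the monomorphism -/
  dom : SimplexCategory
  /-- the monomorphism -/
  incl : dom ⟶ a
  mono : Mono incl

namespace Face

variable {a : SimplexCategory}

instance (x : Face a) : Mono x.incl := x.mono

/-- The category of faces of `a` is the full subcategory of the category of objects over `a`
consisting of monomorphisms. -/
instance : Category (Face a) where
  Hom x y := {h : x.dom ⟶ y.dom // h ≫ y.incl = x.incl}
  id x := ⟨𝟙 _, Category.id_comp _⟩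
  comp f g := ⟨f.1 ≫ g.1, by rw [Category.assoc, g.2, f.2]⟩

instance : Quiver.IsThin (Face a) := fun x y =>
  ⟨fun f g => Subtype.ext (by rw [← cancel_mono y.incl, f.2, g.2])⟩

theorem len_dom_le (x : Face a) : x.dom.len ≤ a.len := SimplexCategory.len_le_of_mono x.incl

instance : Finite (Face a) := by
  have (m : Fin (a.len + 1)) : Finite (SimplexCategory.mk m.1 ⟶ a) :=
    finite_simplexCategory_hom _ _
  refine Finite.of_surjective
    (α := {x : (Σ m : Fin (a.len + 1), (SimplexCategory.mk m.1 ⟶ a)) // Mono x.2})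
    (fun x => ⟨_, x.1.2, x.2⟩) ?_
  intro x
  exact ⟨⟨⟨⟨x.dom.len, Nat.lt_succ_of_le x.len_dom_le⟩, x.incl⟩, x.mono⟩, rfl⟩

/-- The functor sending a face to the corresponding simplex. -/
def forget (a : SimplexCategory) : Face a ⥤ SimplexCategory where
  obj x := x.dom
  map f := f.1

theorem mono_hom {x y : Face a} (f : x ⟶ y) : Mono f.1 :=
  have : Mono (f.1 ≫ y.incl) := by rw [f.2]; infer_instance
  mono_of_mono f.1 y.incl

theorem len_le {x y : Face a} (f : x ⟶ y) : x.dom.len ≤ y.dom.len :=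
  have := mono_hom f
  SimplexCategory.len_le_of_mono f.1

/-- A map of faces between faces of the same dimension is invertible. -/
theorem nonempty_hom_of_len_eq {x y : Face a} (f : x ⟶ y) (h : y.dom.len ≤ x.dom.len) :
    Nonempty (y ⟶ x) := by
  have := mono_hom f
  have : IsIso f.1 := SimplexCategory.isIso_of_bijective (by
    refine (Fintype.bijective_iff_injective_and_card _).2
      ⟨SimplexCategory.mono_iff_injective.1 this, ?_⟩
    simpa using le_antisymm (len_le f) h)
  exact ⟨⟨inv f.1, by rw [IsIso.inv_comp_eq, f.2]⟩⟩

end Face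

theorem exists_factor_of_range_subset {a b c : SimplexCategory} (f : a ⟶ c) (k : b ⟶ c) [Mono k]
    (h : Set.range f.toOrderHom ⊆ Set.range k.toOrderHom) : ∃ f' : a ⟶ b, f' ≫ k = f := by
  have hk := SimplexCategory.mono_iff_injective.1 (‹Mono k›)
  have hk' : StrictMono k.toOrderHom := k.toOrderHom.monotone.strictMono_of_injective hk
  choose g hg using fun x => h ⟨x, rfl⟩
  refine ⟨SimplexCategory.Hom.mk ⟨g, fun x y hxy => ?_⟩, ?_⟩
  · rw [← hk'.le_iff_le, hg, hg]
    exact f.toOrderHom.monotone hxy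
  · ext x : 3
    exact hg x

theorem exists_mono_range_eq {a : SimplexCategory} (s : Set (Fin (a.len + 1))) (hs : s.Nonempty) :
    ∃ (b : SimplexCategory) (k : b ⟶ a), Mono k ∧ Set.range k.toOrderHom = s := by
  classical
  have hc : s.toFinset.card = (s.toFinset.card - 1) + 1 :=
    (Nat.succ_pred_eq_of_pos (Finset.card_pos.2 (Set.toFinset_nonempty.2 hs))).symm
  refine ⟨⦋s.toFinset.card - 1⦌,
    SimplexCategory.Hom.mk (s.toFinset.orderEmbOfFin hc).toOrderHom, ?_, ?_⟩
  · exact SimplexCategory.mono_iff_injective.2 (s.toFinset.orderEmbOfFin hc).injective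
  · exact (Finset.range_orderEmbOfFin _ hc).trans (by simp)

theorem isIso_iff_surjective_of_mono {a b : SimplexCategory} (f : a ⟶ b) [Mono f] :
    IsIso f ↔ Function.Surjective f.toOrderHom := by
  constructor
  · intro h
    exact SimplexCategory.epi_iff_surjective.1 inferInstance
  · intro h
    exact SimplexCategory.isIso_of_bijective
      ⟨SimplexCategory.mono_iff_injective.1 inferInstance, h⟩

namespace Face

variable {a : SimplexCategory}

/-- A face of a face. -/
abbrev comp (x : Face a) {c : SimplexCategory} (f : c ⟶ x.dom) (hf : Mono f) : Face a where
  dom := c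
  incl := f ≫ x.incl
  mono := mono_comp _ _

/-- The inclusion of a face of a face. -/
abbrev compHom (x : Face a) {c : SimplexCategory} (f : c ⟶ x.dom) (hf : Mono f) :
    x.comp f hf ⟶ x := ⟨f, rfl⟩

theorem isEmpty_hom_comp (x : Face a) {c : SimplexCategory} (f : c ⟶ x.dom) (hf : Mono f)
    (hf' : ¬ IsIso f) : IsEmpty (x ⟶ x.comp f hf) := ⟨fun g => hf' (by
  have h₁ : g ≫ x.compHom f hf = 𝟙 x := Subsingleton.elim _ _
  have h₂ : x.compHom f hf ≫ g = 𝟙 _ := Subsingleton.elim _ _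
  exact ⟨g.1, congrArg Subtype.val h₂, congrArg Subtype.val h₁⟩)⟩

theorem not_isIso {x y : Face a} (f : y ⟶ x) (h : IsEmpty (x ⟶ y)) : ¬ IsIso f.1 := fun _ =>
  h.false ⟨inv f.1, by rw [IsIso.inv_comp_eq, f.2]⟩

theorem len_lt {x y : Face a} (f : y ⟶ x) (h : IsEmpty (x ⟶ y)) : y.dom.len < x.dom.len :=
  not_le.1 fun h' => h.false (nonempty_hom_of_len_eq f h').some

end Face

/-! ### Reedy cofibrant objects are levelwise cofibrant -/

theorem isCofibrant_of_isReedyCofibrant {M : Type u} [Category.{v} M] [ModelCategory M]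
    (X : SimplexCategory ⥤ M) (hX : IsReedyCofibrant (M := M) X) (a : SimplexCategory) :
    IsCofibrant (X.obj a) := by
  refine isCofibrant_of_exists_lift fun {E S} p hp hp' y => ?_
  -- a lift is constructed on all the faces of `a`, by induction on the dimension
  obtain ⟨e', -, h₂, -⟩ := exists_extension_of_lowerSet (Face.forget a ⋙ X) p
    (fun x => X.map x.incl ≫ y)
    (fun {j k} φ => by
      rw [← φ.2]
      exact (X.map_comp_assoc φ.1 k.incl y).symm)
    (fun x => x.dom.len) (fun φ h => Face.len_lt φ h)
    (fun x e he hep => by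
      have hcof := hX x.dom.len
      obtain ⟨d, hd⟩ := exists_desc_map_latchingObj X x.dom.len (𝟭 M) (E := E)
        (fun c f hf hf' => e (x.comp f hf) (x.compHom f hf) (x.isEmpty_hom_comp f hf hf'))
        (fun c c' h f hf hf' hh hh' =>
          he (x.comp (h ≫ f) hh) (x.comp f hf) ⟨h, (Category.assoc _ _ _).symm⟩ _ _ _ _)
      have sq : CommSq (show latchingObj (M := M) X x.dom.len ⟶ E from d)
          (latchingMap (M := M) X x.dom.len) p (X.map x.incl ≫ y) :=
        ⟨latchingObj_hom_ext X fun c f hf hf' => by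
          have h₁ := hd f hf hf'
          have h₂ := hep (x.comp f hf) (x.compHom f hf) (x.isEmpty_hom_comp f hf hf')
          rw [← h₁] at h₂
          refine (Category.assoc _ _ _).symm.trans (h₂.trans ?_)
          rw [← Category.assoc (latchingι X f hf hf'), latchingι_latchingMap, ← Category.assoc,
            ← X.map_comp]
          rfl⟩
      have : HasLiftingProperty (latchingMap (M := M) X x.dom.len) p :=
        ModelCategory.cm4b _ _
      refine ⟨sq.lift, sq.fac_right, fun z hz hz' => ?_⟩
      have hm := Face.mono_hom hz
      have hi := Face.not_isIso hz hz'
      have h₁ := he z (x.comp hz.1 hm) ⟨𝟙 _, (Category.id_comp _).trans hz.2⟩ hz hz'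
        (x.compHom hz.1 hm) (x.isEmpty_hom_comp hz.1 hm hi)
      have h₂ : X.map hz.1 ≫ sq.lift =
          e (x.comp hz.1 hm) (x.compHom hz.1 hm) (x.isEmpty_hom_comp hz.1 hm hi) := by
        rw [← hd hz.1 hm hi, ← latchingι_latchingMap X hz.1 hm hi, Category.assoc, sq.fac_left]
        rfl
      refine h₂.trans (Eq.trans ?_ h₁)
      exact ((congrArg (· ≫ _) (X.map_id _)).trans (Category.id_comp _)).symm)
    (fun _ => False) (fun _ h => h) (fun _ h => h.elim) (fun _ h => h.elim) (fun _ h => h.elim)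
  exact ⟨e' ⟨a, 𝟙 a, inferInstance⟩, (h₂ ⟨a, 𝟙 a, inferInstance⟩).trans
    ((congrArg (· ≫ y) (X.map_id a)).trans (Category.id_comp y))⟩

/-! ### Bifunctors satisfying the pushout-product axiom -/

section Bifunctor

variable {C₁ : Type u₁} [Category.{v₁} C₁] {C₂ : Type u₂} [Category.{v₂} C₂]
  {C₃ : Type u₃} [Category.{v₃} C₃] (T : C₁ ⥤ C₂ ⥤ C₃)

/-- The action of a bifunctor on a pair of morphisms. -/
def bimap {X X' : C₁} {Y Y' : C₂} (f : X ⟶ X') (g : Y ⟶ Y') :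
    (T.obj X).obj Y ⟶ (T.obj X').obj Y' :=
  (T.map f).app Y ≫ (T.obj X').map g

theorem bimap_id (X : C₁) (Y : C₂) : bimap T (𝟙 X) (𝟙 Y) = 𝟙 _ := by simp [bimap]

theorem bimap_comp {X X' X'' : C₁} {Y Y' Y'' : C₂} (f : X ⟶ X') (f' : X' ⟶ X'') (g : Y ⟶ Y')
    (g' : Y' ⟶ Y'') : bimap T f g ≫ bimap T f' g' = bimap T (f ≫ f') (g ≫ g') := by
  simp [bimap]

theorem bimap_comp_assoc {X X' X'' : C₁} {Y Y' Y'' : C₂} (f : X ⟶ X') (f' : X' ⟶ X'')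
    (g : Y ⟶ Y') (g' : Y' ⟶ Y'') {Z : C₃} (h : (T.obj X'').obj Y'' ⟶ Z) :
    bimap T f g ≫ bimap T f' g' ≫ h = bimap T (f ≫ f') (g ≫ g') ≫ h := by
  rw [← Category.assoc, bimap_comp]

theorem bimap_id_left (X : C₁) {Y Y' : C₂} (g : Y ⟶ Y') :
    bimap T (𝟙 X) g = (T.obj X).map g := by simp [bimap]

theorem bimap_id_right {X X' : C₁} (f : X ⟶ X') (Y : C₂) :
    bimap T f (𝟙 Y) = (T.map f).app Y := by simp [bimap]

/-- The diagonal of the bicosimplicial object `T(Pᵐ, Qⁿ)`. -/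
abbrev diagonal (P : SimplexCategory ⥤ C₁) (Q : SimplexCategory ⥤ C₂) : SimplexCategory ⥤ C₃ where
  obj a := (T.obj (P.obj a)).obj (Q.obj a)
  map f := bimap T (P.map f) (Q.map f)
  map_id a := by rw [P.map_id, Q.map_id, bimap_id]
  map_comp f g := by rw [P.map_comp, Q.map_comp, bimap_comp]

theorem diagonal_map (P : SimplexCategory ⥤ C₁) (Q : SimplexCategory ⥤ C₂) {a b : SimplexCategory}
    (f : a ⟶ b) : (diagonal T P Q).map f = bimap T (P.map f) (Q.map f) := rfl

variable {T}

variable [ModelCategory C₃]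

/-- The left lifting property of a pushout-product, in terms of pairs of maps which agree on
`T(A, X)`. -/
theorem exists_lift_of_hasLiftingProperty_pushoutProduct {A B : C₁} {X Y : C₂} (i : A ⟶ B)
    (j : X ⟶ Y) {E S : C₃} (p : E ⟶ S)
    (h : HasLiftingProperty (Functor.PushoutObjObj.ofHasPushout T i j).ι p)
    (e₁ : (T.obj B).obj X ⟶ E) (e₂ : (T.obj A).obj Y ⟶ E)
    (h₁₂ : (T.map i).app X ≫ e₁ = (T.obj A).map j ≫ e₂) (v : (T.obj B).obj Y ⟶ S)
    (h₁ : e₁ ≫ p = (T.obj B).map j ≫ v) (h₂ : e₂ ≫ p = (T.map i).app Y ≫ v) :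
    ∃ l : (T.obj B).obj Y ⟶ E, l ≫ p = v ∧ (T.obj B).map j ≫ l = e₁ ∧
      (T.map i).app Y ≫ l = e₂ := by
  let sq := Functor.PushoutObjObj.ofHasPushout T i j
  have csq : CommSq (sq.isPushout.desc e₁ e₂ h₁₂) sq.ι p v := ⟨by
    apply sq.hom_ext
    · simpa using h₁
    · simpa using h₂⟩
  have : HasLiftingProperty sq.ι p := h
  refine ⟨csq.lift, csq.fac_right, ?_, ?_⟩
  · rw [← sq.inl_ι, Category.assoc, csq.fac_left, sq.isPushout.inl_desc]
  · rw [← sq.inr_ι, Category.assoc, csq.fac_left, sq.isPushout.inr_desc]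

variable [ModelCategory C₁] [∀ Y, PreservesFiniteColimits (T.flip.obj Y)]

/-- The left lifting property of the pushout-product of `⊥ ⟶ B` and `j` is that of `T(B, j)`: since
`T(-, Y)` preserves initial objects, `T(⊥, Y)` is initial. -/
theorem exists_lift_map_of_hasLiftingProperty {B : C₁} {X Y : C₂} (j : X ⟶ Y) {E S : C₃} (p : E ⟶ S)
    (h : HasLiftingProperty (Functor.PushoutObjObj.ofHasPushout T (initial.to B) j).ι p)
    (e : (T.obj B).obj X ⟶ E) (v : (T.obj B).obj Y ⟶ S) (hev : e ≫ p = (T.obj B).map j ≫ v) :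
    ∃ l : (T.obj B).obj Y ⟶ E, (T.obj B).map j ≫ l = e ∧ l ≫ p = v := by
  have hi : ∀ Y : C₂, IsInitial ((T.obj (⊥_ C₁)).obj Y) := fun Y =>
    IsInitial.isInitialObj (T.flip.obj Y) _ initialIsInitial
  obtain ⟨l, h₁, h₂, -⟩ := exists_lift_of_hasLiftingProperty_pushoutProduct (initial.to B) j p h e
    ((hi Y).to E) ((hi X).hom_ext _ _) v hev ((hi Y).hom_ext _ _)
  exact ⟨l, h₂, h₁⟩

variable [ModelCategory C₂]

theorem cofibration_obj_map (hT : PushoutProductAxiom T) {B : C₁} (hB : IsCofibrant B) {X Y : C₂}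
    (j : X ⟶ Y) (hj : Cofibration j) : Cofibration ((T.obj B).map j) := by
  refine cofibration_of_exists_lift _ fun p _ _ x y hxy => ?_
  have := hT.cofibration (initial.to B) j ((isCofibrant_iff B).1 hB) hj
  exact exists_lift_map_of_hasLiftingProperty j p (ModelCategory.cm4b _ _) x y hxy

theorem weakEquivalence_obj_map (hT : PushoutProductAxiom T) {B : C₁} (hB : IsCofibrant B)
    {X Y : C₂} (j : X ⟶ Y) (hj : Cofibration j) (hj' : WeakEquivalence j) :
    WeakEquivalence ((T.obj B).map j) := by
  refine (trivialCofibration_of_exists_lift _ fun p _ x y hxy => ?_).2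
  have h := (isCofibrant_iff B).1 hB
  have := hT.cofibration (initial.to B) j h hj
  have := hT.weakEquivalence (initial.to B) j h hj (Or.inr hj')
  exact exists_lift_map_of_hasLiftingProperty j p (ModelCategory.cm4a _ _) x y hxy

variable [∀ X, PreservesFiniteColimits (T.obj X)]

/-- A functor `T(B, -)` with `B` cofibrant preserves Reedy cofibrant objects. -/
theorem isReedyCofibrant_comp_obj (hT : PushoutProductAxiom T) {B : C₁} (hB : IsCofibrant B)
    (Q : SimplexCategory ⥤ C₂) (hQ : IsReedyCofibrant (M := C₂) Q) :
    IsReedyCofibrant (M := C₃) (Q ⋙ T.obj B) := by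
  intro n
  refine cofibration_latchingMap_of_exists_lift _ n fun {E S} p _ _ u v hu huv => ?_
  have := cofibration_obj_map hT hB _ (hQ n)
  obtain ⟨d, hd⟩ := exists_desc_map_latchingObj Q n (T.obj B) u hu
  have sq : CommSq d ((T.obj B).map (latchingMap (M := C₂) Q n)) p v :=
    ⟨map_latchingObj_hom_ext Q _ fun c f hf hf' => by
      rw [← Category.assoc, hd, huv, ← Category.assoc, ← Functor.map_comp, latchingι_latchingMap]
      rfl⟩
  refine ⟨sq.lift, sq.fac_right, fun c f hf hf' => ?_⟩
  refine Eq.trans ?_ ((congrArg (_ ≫ ·) sq.fac_left).trans (hd f hf hf'))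
  rw [← Category.assoc, ← Functor.map_comp, latchingι_latchingMap]
  rfl

/-- The extension property of the relative latching map of the bicosimplicial object `T(Pᵐ, Qⁿ)`,
which is the pushout-product of the latching maps of `P` and `Q`. -/
theorem exists_lift_of_latchingMaps (hT : PushoutProductAxiom T) (P : SimplexCategory ⥤ C₁)
    (Q : SimplexCategory ⥤ C₂) (m n : ℕ) (hP : Cofibration (latchingMap (M := C₁) P m))
    (hQ : Cofibration (latchingMap (M := C₂) Q n)) {E S : C₃} (p : E ⟶ S) [Fibration p]
    [WeakEquivalence p]
    (e₁ : ∀ ⦃c : SimplexCategory⦄ (f : c ⟶ ⦋m⦌), Mono f → ¬ IsIso f →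
      ((T.obj (P.obj c)).obj (Q.obj ⦋n⦌) ⟶ E))
    (h₁ : ∀ ⦃c c' : SimplexCategory⦄ (h : c ⟶ c') (f : c' ⟶ ⦋m⦌) (hf : Mono f) (hf' : ¬ IsIso f)
      (hh : Mono (h ≫ f)) (hh' : ¬ IsIso (h ≫ f)),
      (T.map (P.map h)).app _ ≫ e₁ f hf hf' = e₁ (h ≫ f) hh hh')
    (e₂ : ∀ ⦃c : SimplexCategory⦄ (f : c ⟶ ⦋n⦌), Mono f → ¬ IsIso f →
      ((T.obj (P.obj ⦋m⦌)).obj (Q.obj c) ⟶ E))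
    (h₂ : ∀ ⦃c c' : SimplexCategory⦄ (h : c ⟶ c') (f : c' ⟶ ⦋n⦌) (hf : Mono f) (hf' : ¬ IsIso f)
      (hh : Mono (h ≫ f)) (hh' : ¬ IsIso (h ≫ f)),
      (T.obj _).map (Q.map h) ≫ e₂ f hf hf' = e₂ (h ≫ f) hh hh')
    (h₁₂ : ∀ ⦃c c' : SimplexCategory⦄ (f : c ⟶ ⦋m⦌) (hf : Mono f) (hf' : ¬ IsIso f)
      (g : c' ⟶ ⦋n⦌) (hg : Mono g) (hg' : ¬ IsIso g),
      (T.obj _).map (Q.map g) ≫ e₁ f hf hf' = (T.map (P.map f)).app _ ≫ e₂ g hg hg')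
    (v : (T.obj (P.obj ⦋m⦌)).obj (Q.obj ⦋n⦌) ⟶ S)
    (hv₁ : ∀ ⦃c : SimplexCategory⦄ (f : c ⟶ ⦋m⦌) (hf : Mono f) (hf' : ¬ IsIso f),
      e₁ f hf hf' ≫ p = (T.map (P.map f)).app _ ≫ v)
    (hv₂ : ∀ ⦃c : SimplexCategory⦄ (f : c ⟶ ⦋n⦌) (hf : Mono f) (hf' : ¬ IsIso f),
      e₂ f hf hf' ≫ p = (T.obj _).map (Q.map f) ≫ v) :
    ∃ l : (T.obj (P.obj ⦋m⦌)).obj (Q.obj ⦋n⦌) ⟶ E, l ≫ p = v ∧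
      (∀ ⦃c : SimplexCategory⦄ (f : c ⟶ ⦋m⦌) (hf : Mono f) (hf' : ¬ IsIso f),
        (T.map (P.map f)).app _ ≫ l = e₁ f hf hf') ∧
      ∀ ⦃c : SimplexCategory⦄ (f : c ⟶ ⦋n⦌) (hf : Mono f) (hf' : ¬ IsIso f),
        (T.obj _).map (Q.map f) ≫ l = e₂ f hf hf' := by
  obtain ⟨d₁, hd₁⟩ := exists_desc_map_latchingObj P m (T.flip.obj (Q.obj ⦋n⦌)) e₁ h₁
  obtain ⟨d₂, hd₂⟩ := exists_desc_map_latchingObj Q n (T.obj (P.obj ⦋m⦌)) e₂ h₂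
  simp only [Functor.flip_obj_map, Functor.flip_obj_obj] at d₁ hd₁
  have hPι : ∀ ⦃c : SimplexCategory⦄ (f : c ⟶ ⦋m⦌) (hf : Mono f) (hf' : ¬ IsIso f) (Y : C₂),
      (T.map (latchingι P f hf hf')).app Y ≫ (T.map (latchingMap (M := C₁) P m)).app Y =
        (T.map (P.map f)).app Y := fun c f hf hf' Y => by
    rw [← latchingι_latchingMap P f hf hf', T.map_comp, NatTrans.comp_app]
  have hQι : ∀ ⦃c : SimplexCategory⦄ (f : c ⟶ ⦋n⦌) (hf : Mono f) (hf' : ¬ IsIso f) (X : C₁),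
      (T.obj X).map (latchingι Q f hf hf') ≫ (T.obj X).map (latchingMap (M := C₂) Q n) =
        (T.obj X).map (Q.map f) := fun c f hf hf' X => by
    rw [← latchingι_latchingMap Q f hf hf', Functor.map_comp]
  have := hT.cofibration _ _ hP hQ
  obtain ⟨l, hl, hl₂, hl₁⟩ := exists_lift_of_hasLiftingProperty_pushoutProduct
    (latchingMap (M := C₁) P m) (latchingMap (M := C₂) Q n) p (ModelCategory.cm4b _ _) d₂ d₁
    (map_latchingObj_hom_ext P (T.flip.obj _) fun c f hf hf' =>
      map_latchingObj_hom_ext Q (T.obj _) fun c' g hg hg' => by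
        have e1 : (T.map (latchingι P f hf hf')).app (latchingObj (M := C₂) Q n) ≫
            (T.map (latchingMap (M := C₁) P m)).app (latchingObj (M := C₂) Q n) ≫ d₂ =
            (T.map (P.map f)).app _ ≫ d₂ := by rw [← Category.assoc, hPι]
        have e2 : (T.map (latchingι P f hf hf')).app (latchingObj (M := C₂) Q n) ≫
            (T.obj (latchingObj (M := C₁) P m)).map (latchingMap (M := C₂) Q n) ≫ d₁ =
            (T.obj _).map (latchingMap (M := C₂) Q n) ≫ e₁ f hf hf' := by
          rw [← hd₁ f hf hf', ← NatTrans.naturality_assoc]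
        simp only [Functor.flip_obj_map]
        refine (congrArg (_ ≫ ·) e1).trans (Eq.trans ?_ (congrArg (_ ≫ ·) e2).symm)
        have e3 := hQι g hg hg' (P.obj c)
        have e4 := hd₂ g hg hg'
        rw [NatTrans.naturality_assoc, e4, ← Category.assoc ((T.obj (P.obj c)).map _), e3, h₁₂])
    v
    (map_latchingObj_hom_ext Q (T.obj _) fun c f hf hf' => by
      rw [← Category.assoc, hd₂, hv₂, ← Category.assoc, hQι])
    (map_latchingObj_hom_ext P (T.flip.obj _) fun c f hf hf' => by
      have e1 := hv₁ f hf hf'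
      rw [← hd₁, ← hPι f hf hf', Category.assoc, Category.assoc] at e1
      exact e1)
  refine ⟨l, hl, fun c f hf hf' => ?_, fun c f hf hf' => ?_⟩
  · rw [← hPι f hf hf', Category.assoc, hl₁, hd₁]
  · rw [← hQι f hf hf', Category.assoc, hl₂, hd₂]

end Bifunctor

/-! ### The diagonal of a tensor product of Reedy cofibrant objects -/

section Diagonal

variable {C₁ : Type u₁} [Category.{v₁} C₁] {C₂ : Type u₂} [Category.{v₂} C₂]
  {C₃ : Type u₃} [Category.{v₃} C₃] (T : C₁ ⥤ C₂ ⥤ C₃)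

/-- The bicosimplicial object `T(Pᵐ, Qⁿ)`, restricted to pairs of faces of a simplex. -/
abbrev facesFunctor (P : SimplexCategory ⥤ C₁) (Q : SimplexCategory ⥤ C₂) (a : SimplexCategory) :
    Face a × Face a ⥤ C₃ where
  obj x := (T.obj (P.obj x.1.dom)).obj (Q.obj x.2.dom)
  map f := bimap T (P.map f.1.1) (Q.map f.2.1)
  map_id x := by
    refine Eq.trans ?_ (bimap_id T _ _)
    congr 1
    · exact P.map_id _
    · exact Q.map_id _
  map_comp f g := by
    rw [bimap_comp]
    congr 1
    · exact P.map_comp _ _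
    · exact Q.map_comp _ _

instance (a : SimplexCategory) : Quiver.IsThin (Face a × Face a) := fun _ _ =>
  ⟨fun _ _ => Prod.ext (Subsingleton.elim _ _) (Subsingleton.elim _ _)⟩

theorem isEmpty_hom_fst_or_snd {a : SimplexCategory} {x y : Face a × Face a}
    (h : IsEmpty (x ⟶ y)) : IsEmpty (x.1 ⟶ y.1) ∨ IsEmpty (x.2 ⟶ y.2) := by
  by_contra! hh
  obtain ⟨⟨f⟩, ⟨g⟩⟩ := hh
  exact h.false (f, g)

variable {T} [ModelCategory C₁] [ModelCategory C₂] [ModelCategory C₃]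
  [∀ X, PreservesFiniteColimits (T.obj X)] [∀ Y, PreservesFiniteColimits (T.flip.obj Y)]

/-- The extension step for the diagram `T(P x, Q y)` of pairs of faces: a compatible family of maps
on the pairs strictly below `x = (x₁, x₂)` is determined by its values at the pairs `(x₁', x₂)` and
`(x₁, x₂')` with one proper face, so that it extends to `x` by the lifting property of the
pushout-product of latching maps. -/
theorem exists_extension_facesFunctor (hT : PushoutProductAxiom T) (P : SimplexCategory ⥤ C₁)
    (Q : SimplexCategory ⥤ C₂) (hP : IsReedyCofibrant (M := C₁) P)
    (hQ : IsReedyCofibrant (M := C₂) Q) (a : SimplexCategory) {E S : C₃} (p : E ⟶ S) [Fibration p]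
    [WeakEquivalence p] (b : ∀ k, (facesFunctor T P Q a).obj k ⟶ S)
    (hb : ∀ {j k : Face a × Face a} (φ : j ⟶ k), (facesFunctor T P Q a).map φ ≫ b k = b j)
    (x : Face a × Face a)
    (e : ∀ y, (y ⟶ x) → IsEmpty (x ⟶ y) → ((facesFunctor T P Q a).obj y ⟶ E))
    (he : ∀ (y z) (φ : y ⟶ z) (hy : y ⟶ x) (hy' : IsEmpty (x ⟶ y)) (hz : z ⟶ x)
      (hz' : IsEmpty (x ⟶ z)), (facesFunctor T P Q a).map φ ≫ e z hz hz' = e y hy hy')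
    (hep : ∀ (y) (hy : y ⟶ x) (hy' : IsEmpty (x ⟶ y)), e y hy hy' ≫ p = b y) :
    ∃ l : (facesFunctor T P Q a).obj x ⟶ E, l ≫ p = b x ∧
      ∀ (y) (hy : y ⟶ x) (hy' : IsEmpty (x ⟶ y)),
        (facesFunctor T P Q a).map hy ≫ l = e y hy hy' := by
  obtain ⟨x₁, x₂⟩ := x
  -- the objects `(x₁', x₂)` and `(x₁, x₂')` for proper faces `x₁'` of `x₁` and `x₂'` of `x₂`
  let y₁ : ∀ {c : SimplexCategory} (f : c ⟶ x₁.dom) (_ : Mono f), Face a × Face a :=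
    fun f hf => (x₁.comp f hf, x₂)
  let y₂ : ∀ {c : SimplexCategory} (f : c ⟶ x₂.dom) (_ : Mono f), Face a × Face a :=
    fun f hf => (x₁, x₂.comp f hf)
  let i₁ : ∀ {c : SimplexCategory} (f : c ⟶ x₁.dom) (hf : Mono f), y₁ f hf ⟶ (x₁, x₂) :=
    fun f hf => (x₁.compHom f hf, 𝟙 x₂)
  let i₂ : ∀ {c : SimplexCategory} (f : c ⟶ x₂.dom) (hf : Mono f), y₂ f hf ⟶ (x₁, x₂) :=
    fun f hf => (𝟙 x₁, x₂.compHom f hf)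
  have n₁ : ∀ {c : SimplexCategory} (f : c ⟶ x₁.dom) (hf : Mono f), ¬ IsIso f →
      IsEmpty ((x₁, x₂) ⟶ y₁ f hf) := fun f hf hf' =>
    ⟨fun g => (x₁.isEmpty_hom_comp f hf hf').false g.1⟩
  have n₂ : ∀ {c : SimplexCategory} (f : c ⟶ x₂.dom) (hf : Mono f), ¬ IsIso f →
      IsEmpty ((x₁, x₂) ⟶ y₂ f hf) := fun f hf hf' =>
    ⟨fun g => (x₂.isEmpty_hom_comp f hf hf').false g.2⟩
  have m₁ : ∀ {x y : Face a} (h : x ⟶ y) (z : Face a),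
      (facesFunctor T P Q a).map ((h, 𝟙 z) : (x, z) ⟶ (y, z)) =
        (T.map (P.map h.1)).app (Q.obj z.dom) := fun h z => by
    rw [← bimap_id_right, ← Q.map_id]
    rfl
  have m₂ : ∀ {x y : Face a} (h : x ⟶ y) (z : Face a),
      (facesFunctor T P Q a).map ((𝟙 z, h) : (z, x) ⟶ (z, y)) =
        (T.obj (P.obj z.dom)).map (Q.map h.1) := fun h z => by
    rw [← bimap_id_left, ← P.map_id]
    rfl
  have m₁' : ∀ {c : SimplexCategory} (f : c ⟶ x₁.dom) (hf : Mono f),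
      (facesFunctor T P Q a).map (i₁ f hf) = (T.map (P.map f)).app (Q.obj x₂.dom) :=
    fun f hf => m₁ _ _
  have m₂' : ∀ {c : SimplexCategory} (f : c ⟶ x₂.dom) (hf : Mono f),
      (facesFunctor T P Q a).map (i₂ f hf) = (T.obj (P.obj x₁.dom)).map (Q.map f) :=
    fun f hf => m₂ _ _
  obtain ⟨l, hl, hl₁, hl₂⟩ := exists_lift_of_latchingMaps hT P Q x₁.dom.len x₂.dom.len (hP _) (hQ _)
    p (fun c f hf hf' => e (y₁ f hf) (i₁ f hf) (n₁ f hf hf'))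
    (fun c c' h f hf hf' hh hh' => by
      let φ : x₁.comp (h ≫ f) hh ⟶ x₁.comp f hf := ⟨h, (Category.assoc _ _ _).symm⟩
      have h₁ := he (y₁ (h ≫ f) hh) (y₁ f hf) (φ, 𝟙 x₂) (i₁ _ _) (n₁ _ _ hh') (i₁ _ _) (n₁ _ _ hf')
      rw [m₁] at h₁
      exact h₁)
    (fun c f hf hf' => e (y₂ f hf) (i₂ f hf) (n₂ f hf hf'))
    (fun c c' h f hf hf' hh hh' => by
      let φ : x₂.comp (h ≫ f) hh ⟶ x₂.comp f hf := ⟨h, (Category.assoc _ _ _).symm⟩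
      have h₁ := he (y₂ (h ≫ f) hh) (y₂ f hf) (𝟙 x₁, φ) (i₂ _ _) (n₂ _ _ hh') (i₂ _ _) (n₂ _ _ hf')
      rw [m₂] at h₁
      exact h₁)
    (fun c c' f hf hf' g hg hg' => by
      let z : Face a × Face a := (x₁.comp f hf, x₂.comp g hg)
      let j₁ : z ⟶ y₁ f hf := (𝟙 _, x₂.compHom g hg)
      let j₂ : z ⟶ y₂ g hg := (x₁.compHom f hf, 𝟙 _)
      have hz : IsEmpty ((x₁, x₂) ⟶ z) :=
        ⟨fun g => (x₁.isEmpty_hom_comp f hf hf').false g.1⟩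
      have h₁ := he z (y₁ f hf) j₁ (j₁ ≫ i₁ f hf) hz (i₁ f hf) (n₁ f hf hf')
      have h₂ := he z (y₂ g hg) j₂ (j₁ ≫ i₁ f hf) hz (i₂ g hg) (n₂ g hg hg')
      rw [← h₂, m₁, m₂] at h₁
      exact h₁)
    (b (x₁, x₂))
    (fun c f hf hf' => (hep (y₁ f hf) _ _).trans ((hb (i₁ f hf)).symm.trans (by rw [m₁'])))
    (fun c f hf hf' => (hep (y₂ f hf) _ _).trans ((hb (i₂ f hf)).symm.trans (by rw [m₂'])))
  refine ⟨l, hl, fun y hy hy' => ?_⟩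
  obtain h | h := isEmpty_hom_fst_or_snd hy'
  · have hm := Face.mono_hom hy.1
    have hi := Face.not_isIso hy.1 h
    let φ : y ⟶ y₁ hy.1.1 hm := (⟨𝟙 _, (Category.id_comp _).trans hy.1.2⟩, hy.2)
    have e₁ : hy = φ ≫ i₁ _ hm := Subsingleton.elim _ _
    rw [← he y _ φ hy hy' (i₁ _ _) (n₁ _ _ hi), ← hl₁ _ hm hi]
    refine (congrArg (fun t => (facesFunctor T P Q a).map t ≫ l) e₁).trans ?_
    rw [Functor.map_comp, Category.assoc, m₁']
  · have hm := Face.mono_hom hy.2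
    have hi := Face.not_isIso hy.2 h
    let φ : y ⟶ y₂ hy.2.1 hm := (hy.1, ⟨𝟙 _, (Category.id_comp _).trans hy.2.2⟩)
    have e₁ : hy = φ ≫ i₂ _ hm := Subsingleton.elim _ _
    rw [← he y _ φ hy hy' (i₂ _ _) (n₂ _ _ hi), ← hl₂ _ hm hi]
    refine (congrArg (fun t => (facesFunctor T P Q a).map t ≫ l) e₁).trans ?_
    rw [Functor.map_comp, Category.assoc, m₂']

/-- The diagonal of the bicosimplicial object `T(Pᵐ, Qⁿ)` is Reedy cofibrant. The latching object
of the diagonal at `⦋n⦌` is the colimit of the `T(P x, Q y)` over the pairs `(x, y)` of faces of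
`⦋n⦌` which are both contained in a common proper face; the other pairs are then attached
one at a time. -/
theorem isReedyCofibrant_diagonal (hT : PushoutProductAxiom T) (P : SimplexCategory ⥤ C₁)
    (Q : SimplexCategory ⥤ C₂) (hP : IsReedyCofibrant (M := C₁) P)
    (hQ : IsReedyCofibrant (M := C₂) Q) : IsReedyCofibrant (M := C₃) (diagonal T P Q) := by
  intro n
  refine cofibration_latchingMap_of_exists_lift _ n fun {E S} p _ _ u v hu huv => ?_
  -- the union of two faces
  have hk : ∀ x : Face ⦋n⦌ × Face ⦋n⦌, ∃ (k : Face ⦋n⦌) (_ : x.1 ⟶ k) (_ : x.2 ⟶ k),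
      Set.range k.incl.toOrderHom =
        Set.range x.1.incl.toOrderHom ∪ Set.range x.2.incl.toOrderHom := by
    intro x
    obtain ⟨c, k, hk, hk'⟩ := exists_mono_range_eq
      (Set.range x.1.incl.toOrderHom ∪ Set.range x.2.incl.toOrderHom) ⟨_, Or.inl ⟨0, rfl⟩⟩
    obtain ⟨f, hf⟩ := exists_factor_of_range_subset x.1.incl k
      (hk'.symm ▸ Set.subset_union_left)
    obtain ⟨g, hg⟩ := exists_factor_of_range_subset x.2.incl k
      (hk'.symm ▸ Set.subset_union_right)
    exact ⟨⟨c, k, hk⟩, ⟨f, hf⟩, ⟨g, hg⟩, hk'⟩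
  choose k f g hkr using hk
  have hkm : ∀ {x y : Face ⦋n⦌ × Face ⦋n⦌} (_ : x ⟶ y) (z : Face ⦋n⦌), (y.1 ⟶ z) → (y.2 ⟶ z) →
      ∃ h : (k x).dom ⟶ z.dom, h ≫ z.incl = (k x).incl := by
    intro x y φ z h₁ h₂
    refine exists_factor_of_range_subset _ _ ?_
    rw [hkr x, ← (φ.1 ≫ h₁).2, ← (φ.2 ≫ h₂).2]
    rintro _ (⟨t, rfl⟩ | ⟨t, rfl⟩)
    · exact ⟨_, rfl⟩
    · exact ⟨_, rfl⟩
  let U : Face ⦋n⦌ × Face ⦋n⦌ → Prop := fun x => ¬ IsIso (k x).incl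
  have hU : ∀ {x y : Face ⦋n⦌ × Face ⦋n⦌} (z : Face ⦋n⦌) (_ : x ⟶ y) (_ : y.1 ⟶ z) (_ : y.2 ⟶ z),
      ¬ IsIso z.incl → U x := by
    intro x y z φ h₁ h₂ hz hx
    obtain ⟨h, hh⟩ := hkm φ z h₁ h₂
    apply hz
    rw [isIso_iff_surjective_of_mono]
    have := (isIso_iff_surjective_of_mono _).1 hx
    rw [← hh] at this
    exact Function.Surjective.of_comp this
  let e : ∀ x, U x → ((facesFunctor T P Q ⦋n⦌).obj x ⟶ E) := fun x hx =>
    bimap T (P.map (f x).1) (Q.map (g x).1) ≫ u (k x).incl (k x).mono hx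
  -- the maps `e` can be computed using any proper face containing two given faces
  have he : ∀ {x y : Face ⦋n⦌ × Face ⦋n⦌} (φ : x ⟶ y) (z : Face ⦋n⦌) (h₁ : y.1 ⟶ z) (h₂ : y.2 ⟶ z)
      (hz : ¬ IsIso z.incl) (hx : U x), (facesFunctor T P Q ⦋n⦌).map φ ≫
        bimap T (P.map h₁.1) (Q.map h₂.1) ≫ u z.incl z.mono hz = e x hx := by
    intro x y φ z h₁ h₂ hz hx
    obtain ⟨h, hh⟩ := hkm φ z h₁ h₂
    have := (k x).mono
    have h₃ := hu h z.incl z.mono hz (by rw [hh]; infer_instance) (by rw [hh]; exact hx)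
    have h₄ : u (h ≫ z.incl) (by rw [hh]; infer_instance) (by rw [hh]; exact hx) =
        u (k x).incl (k x).mono hx := by congr 1
    have h₅ : φ.1.1 ≫ h₁.1 = (f x).1 ≫ h := by
      rw [← cancel_mono z.incl]
      simp only [Category.assoc, h₁.2, φ.1.2, hh, (f x).2]
    have h₆ : φ.2.1 ≫ h₂.1 = (g x).1 ≫ h := by
      rw [← cancel_mono z.incl]
      simp only [Category.assoc, h₂.2, φ.2.2, hh, (g x).2]
    dsimp only [e]
    rw [← h₄, ← h₃, bimap_comp_assoc, diagonal_map, bimap_comp_assoc,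
      ← P.map_comp, ← P.map_comp, ← Q.map_comp, ← Q.map_comp, h₅, h₆]
  let b : ∀ x, (facesFunctor T P Q ⦋n⦌).obj x ⟶ S := fun x =>
    bimap T (P.map x.1.incl) (Q.map x.2.incl) ≫ v
  obtain ⟨e', h₁, h₂, h₃⟩ := exists_extension_of_lowerSet (facesFunctor T P Q ⦋n⦌) p b
    (fun {x y} φ => by
      dsimp only [b]
      rw [bimap_comp_assoc, ← P.map_comp, ← Q.map_comp, φ.1.2, φ.2.2])
    (fun x => x.1.dom.len + x.2.dom.len)
    (fun φ h => by
      obtain h | h := isEmpty_hom_fst_or_snd h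
      · exact add_lt_add_of_lt_of_le (Face.len_lt φ.1 h) (Face.len_le φ.2)
      · exact add_lt_add_of_le_of_lt (Face.len_le φ.1) (Face.len_lt φ.2 h))
    (fun x e he hep => exists_extension_facesFunctor hT P Q hP hQ _ p b (fun {x y} φ => by
      dsimp only [b]
      rw [bimap_comp_assoc, ← P.map_comp, ← Q.map_comp, φ.1.2, φ.2.2])
      x e he hep)
    U (fun {x y} φ hy => hU (k y) φ (f y) (g y) hy) e
    (fun {x y} φ hx hy => he φ (k y) (f y) (g y) hy hx)
    (fun x hx => by
      dsimp only [e, b]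
      rw [Category.assoc, huv, diagonal_map, bimap_comp_assoc, ← P.map_comp, ← Q.map_comp,
        (f x).2, (g x).2])
  let t : Face ⦋n⦌ := ⟨⦋n⦌, 𝟙 _, inferInstance⟩
  have key : e' (t, t) ≫ p = v := by
    rw [h₂]
    dsimp only [b, t]
    rw [P.map_id, Q.map_id, bimap_id]
    exact Category.id_comp _
  refine ⟨e' (t, t), key, fun c f hf hf' => ?_⟩
  let s : Face ⦋n⦌ := ⟨c, f, hf⟩
  let φ : s ⟶ t := ⟨f, Category.comp_id f⟩
  have hs : U (s, s) := hU s (𝟙 (s, s)) (𝟙 s) (𝟙 s) hf'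
  have h₄ := h₁ ((φ, φ) : (s, s) ⟶ (t, t))
  rw [h₃ _ hs, ← he (𝟙 (s, s)) s (𝟙 s) (𝟙 s) hf' hs, CategoryTheory.Functor.map_id] at h₄
  refine h₄.trans ((Category.id_comp _).trans ?_)
  have h₅ : bimap T (P.map (𝟙 s : s ⟶ s).1) (Q.map (𝟙 s : s ⟶ s).1) = 𝟙 _ :=
    (congrArg₂ (bimap T) (P.map_id c) (Q.map_id c)).trans (bimap_id T _ _)
  exact (congrArg (· ≫ _) h₅).trans (Category.id_comp _)

end Diagonal

/-! ### Cosimplicial objects in additive categories -/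

section HornFilling

variable {C : Type u} [Category.{v} C] [Preadditive C]

/-- The abelian group valued simplicial object `Hom(X, E)` satisfies the Kan condition. -/
theorem exists_horn_filler (X : SimplexCategory ⥤ C) {E : C} (m : ℕ)
    (x : Fin (m + 3) → (X.obj ⦋m + 1⦌ ⟶ E))
    (hx : ∀ i j : Fin (m + 2), i ≤ j → X.map (SimplexCategory.δ i) ≫ x j.succ =
      X.map (SimplexCategory.δ j) ≫ x i.castSucc) :
    ∃ w : X.obj ⦋m + 2⦌ ⟶ E, ∀ i : Fin (m + 2),
      X.map (SimplexCategory.δ i.succ) ≫ w = x i.succ := by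
  -- the faces are corrected one at a time, in decreasing order
  have key : ∀ r : ℕ, r ≤ m + 2 → ∃ w : X.obj ⦋m + 2⦌ ⟶ E, ∀ i : Fin (m + 2),
      m + 2 ≤ i.1 + r → X.map (SimplexCategory.δ i.succ) ≫ w = x i.succ := by
    intro r
    induction r with
    | zero => exact fun _ => ⟨X.map (SimplexCategory.σ 0) ≫ x 0, fun i hi => by lia⟩
    | succ r ih =>
      intro hr
      obtain ⟨w, hw⟩ := ih (by lia)
      let j : Fin (m + 2) := ⟨m + 1 - r, by lia⟩
      refine ⟨w + X.map (SimplexCategory.σ j) ≫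
        (x j.succ - X.map (SimplexCategory.δ j.succ) ≫ w), fun i hi => ?_⟩
      rw [Preadditive.comp_add, ← Category.assoc, ← X.map_comp]
      obtain rfl | hij := eq_or_ne i j
      · rw [SimplexCategory.δ_comp_σ_succ, X.map_id, Category.id_comp, add_sub_cancel]
      · have hij' : j < i := lt_of_le_of_ne
          (by rw [Fin.le_def]; simp only [j]; lia) hij.symm
        obtain ⟨j₀, hj₀⟩ := Fin.exists_castSucc_eq.2
          (ne_of_lt (lt_of_lt_of_le hij' (Fin.le_last i)))
        rw [← hj₀] at hij' ⊢
        have hle : j₀.succ ≤ i := Fin.le_def.2 (Nat.succ_le_of_lt (Fin.lt_def.1 hij'))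
        rw [SimplexCategory.δ_comp_σ_of_gt hij', hw i (by
          have := Fin.lt_def.1 hij'
          rw [hj₀] at this
          simp only [j] at this
          lia), X.map_comp, Category.assoc, Preadditive.comp_sub, ← Category.assoc (X.map _) _ w,
          ← X.map_comp, Fin.succ_castSucc, ← hx _ _ hle,
          ← SimplexCategory.δ_comp_δ hle, X.map_comp, Category.assoc, hw i (by
            have := Fin.lt_def.1 hij'
            rw [hj₀] at this
            simp only [j] at this
            lia), sub_self, comp_zero, add_zero]
  obtain ⟨w, hw⟩ := key (m + 2) le_rfl
  exact ⟨w, fun i => hw i (by lia)⟩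

end HornFilling

/-! ### The cosimplicial object attached to a cochain complex -/

section DoldKan

open AlgebraicTopology AlgebraicTopology.DoldKan SimplicialObject

variable {C : Type u} [Category.{v} C] [Preadditive C] [HasFiniteProducts C]
  (K : ChainComplex Cᵒᵖ ℕ)

/-- The cosimplicial object in `C` attached by the Dold-Kan correspondence in `Cᵒᵖ` to a cochain
complex in `C`, which is regarded as a chain complex in `Cᵒᵖ`. -/
noncomputable abbrev coΓ : SimplexCategory ⥤ C :=
  Functor.unop (Γ₀.obj K : SimplexCategoryᵒᵖ ⥤ Cᵒᵖ)

/-- The projection to the nondegenerate summand. (The opposite category turns the inclusion of a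
summand into a projection.) -/
noncomputable def toNormalized (n : ℕ) :
    (coΓ K).obj ⦋n⦌ ⟶ (K.X n).unop :=
  (((Γ₀.splitting K).cofan (op ⦋n⦌)).inj (Splitting.IndexSet.id (op ⦋n⦌))).unop

/-- The inclusion of the nondegenerate summand. -/
noncomputable def ofNormalized (n : ℕ) :
    (K.X n).unop ⟶ (coΓ K).obj ⦋n⦌ :=
  ((Γ₀.splitting K).πSummand (Splitting.IndexSet.id (op ⦋n⦌))).unop

theorem ofNormalized_toNormalized (n : ℕ) : ofNormalized K n ≫ toNormalized K n = 𝟙 _ :=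
  Quiver.Hom.op_inj ((Γ₀.splitting K).cofan_inj_πSummand_eq_id (Splitting.IndexSet.id (op ⦋n⦌)))

/-- The positive cofaces vanish on the nondegenerate summand, on which the coface `δ⁰` is the
differential. -/
theorem δ_succ_toNormalized (n : ℕ) (i : Fin (n + 1)) :
    (coΓ K).map (SimplexCategory.δ i.succ) ≫ toNormalized K (n + 1) = 0 :=
  Quiver.Hom.op_inj (HigherFacesVanish.on_Γ₀_summand_id K n i (by lia))

theorem δ_zero_toNormalized (n : ℕ) :
    (coΓ K).map (SimplexCategory.δ 0) ≫ toNormalized K (n + 1) =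
      toNormalized K n ≫ (K.d (n + 1) n).unop :=
  Quiver.Hom.op_inj ((Γ₀.Obj.mapMono_on_summand_id K (SimplexCategory.δ (0 : Fin (n + 2)))).trans
    (by rw [Γ₀.Obj.Termwise.mapMono_δ₀]; rfl))

/-- On the simplicial object attached to a chain complex, the projection to the Moore complex is the
projection to the nondegenerate summand. -/
theorem PInfty_f_eq (n : ℕ) : (PInfty (X := Γ₀.obj K)).f n =
    (Γ₀.splitting K).πSummand (Splitting.IndexSet.id (op ⦋n⦌)) ≫
      ((Γ₀.splitting K).cofan (op ⦋n⦌)).inj (Splitting.IndexSet.id (op ⦋n⦌)) := by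
  rw [← (Γ₀.splitting K).πSummand_comp_cofan_inj_id_comp_PInfty_eq_PInfty n]
  exact congrArg (_ ≫ ·) (PInfty_on_Γ₀_splitting_summand_eq_self K)

/-- A map on which the positive cofaces vanish factors through the nondegenerate summand. -/
theorem eq_toNormalized_comp {E : C} (n : ℕ) (x : (coΓ K).obj ⦋n + 1⦌ ⟶ E)
    (hx : ∀ i : Fin (n + 1),
      (coΓ K).map (SimplexCategory.δ i.succ) ≫ x = 0) :
    toNormalized K (n + 1) ≫ ofNormalized K (n + 1) ≫ x = x := by
  have h : HigherFacesVanish (n + 1) (Y := op E) (X := Γ₀.obj K) x.op := fun i _ =>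
    Quiver.Hom.unop_inj (hx i)
  have h' := h.comp_P_eq_self
  rw [← PInfty_f, PInfty_f_eq] at h'
  exact Quiver.Hom.op_inj ((Category.assoc _ _ _).trans h')

theorem toNormalized_zero_comp :
    toNormalized K 0 ≫ ofNormalized K 0 = 𝟙 _ := by
  have h := PInfty_f_eq K 0
  rw [PInfty_f_0] at h
  exact Quiver.Hom.op_inj h.symm

end DoldKan

section DoldKanReedy

open AlgebraicTopology AlgebraicTopology.DoldKan SimplicialObject

variable {C : Type u} [Category.{v} C] [Preadditive C] [ModelCategory C]
  (K : ChainComplex Cᵒᵖ ℕ)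

theorem not_isIso_δ {n : ℕ} (i : Fin (n + 2)) : ¬ IsIso (SimplexCategory.δ i) := fun _ => by
  have := SimplexCategory.len_le_of_epi (SimplexCategory.δ i)
  simp at this

/-- Let `K` be a cochain complex such that `K⁰` is cofibrant and such that a cochain `Kⁿ⁺¹ ⟶ S` can
be lifted along any trivial fibration `E ⟶ S`, extending any given cocycle on `Kⁿ`. Then the
cosimplicial object attached to `K` is Reedy cofibrant: a simplicial abelian group satisfies the
Kan condition, and this reduces the extension of maps from the boundary of a simplex to the case
of maps which vanish on all positive faces. -/
theorem isReedyCofibrant_coΓ (h₀ : IsCofibrant (K.X 0).unop)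
    (hK : ∀ (n : ℕ) {E S : C} (p : E ⟶ S), Fibration p → WeakEquivalence p →
      ∀ (z : (K.X n).unop ⟶ E) (y : (K.X (n + 1)).unop ⟶ S),
        (∀ m, (K.d n m).unop ≫ z = 0) → z ≫ p = (K.d (n + 1) n).unop ≫ y →
        ∃ l : (K.X (n + 1)).unop ⟶ E, (K.d (n + 1) n).unop ≫ l = z ∧ l ≫ p = y) :
    IsReedyCofibrant (M := C) (coΓ K) := by
  intro n
  refine cofibration_latchingMap_of_exists_lift _ n fun {E S} p _ _ u v hu huv => ?_
  obtain _ | n := n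
  · obtain ⟨l, hl⟩ := exists_lift_of_isCofibrant h₀ p (ofNormalized K 0 ≫ v)
    refine ⟨toNormalized K 0 ≫ l, ?_, fun c f hf hf' => ?_⟩
    · rw [Category.assoc, hl, ← Category.assoc, toNormalized_zero_comp, Category.id_comp]
    · exact (hf' ((isIso_iff_surjective_of_mono f).2
        fun y => ⟨0, Subsingleton.elim (α := Fin 1) _ _⟩)).elim
  let x : Fin (n + 2) → ((coΓ K).obj ⦋n⦌ ⟶ E) := fun i =>
    u (SimplexCategory.δ i) inferInstance (not_isIso_δ i)
  have hxv : ∀ i, x i ≫ p = (coΓ K).map (SimplexCategory.δ i) ≫ v := fun i => huv _ _ _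
  have hcomp : ∀ {c : SimplexCategory} (f : c ⟶ ⦋n + 1⦌) (hf : Mono f) (hf' : ¬ IsIso f)
      (i : Fin (n + 2)) (h : c ⟶ ⦋n⦌), f = h ≫ SimplexCategory.δ i →
      (coΓ K).map h ≫ x i = u f hf hf' := by
    rintro c f hf hf' i h rfl
    exact hu h _ _ _ _ _
  -- a map `w` with the prescribed restrictions to the positive faces
  obtain ⟨w, hw, hx₀, hw₀⟩ : ∃ w : (coΓ K).obj ⦋n + 1⦌ ⟶ E,
      (∀ i : Fin (n + 1), (coΓ K).map (SimplexCategory.δ i.succ) ≫ w = x i.succ) ∧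
      toNormalized K n ≫ ofNormalized K n ≫
        (x 0 - (coΓ K).map (SimplexCategory.δ 0) ≫ w) =
          x 0 - (coΓ K).map (SimplexCategory.δ 0) ≫ w ∧
      ∀ m, (K.d n m).unop ≫ ofNormalized K n ≫
        (x 0 - (coΓ K).map (SimplexCategory.δ 0) ≫ w) = 0 := by
    obtain _ | n := n
    · refine ⟨(coΓ K).map (SimplexCategory.σ 0) ≫ x 1, fun i => ?_, ?_, fun m => ?_⟩
      · obtain rfl := Subsingleton.elim (α := Fin 1) i 0
        rw [← Category.assoc, ← (coΓ K).map_comp, SimplexCategory.δ_comp_σ_succ, (coΓ K).map_id,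
          Category.id_comp]
        rfl
      · rw [← Category.assoc, toNormalized_zero_comp, Category.id_comp]
      · rw [K.shape 0 m (by simp), unop_zero, zero_comp]
    · have hxx : ∀ i j : Fin (n + 2), i ≤ j → (coΓ K).map (SimplexCategory.δ i) ≫ x j.succ =
          (coΓ K).map (SimplexCategory.δ j) ≫ x i.castSucc := fun i j hij => by
        rw [hcomp (SimplexCategory.δ i ≫ SimplexCategory.δ j.succ) inferInstance ?_ _ _ rfl,
          hcomp (SimplexCategory.δ i ≫ SimplexCategory.δ j.succ) inferInstance ?_ _ _
            (SimplexCategory.δ_comp_δ hij)]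
        intro h
        have := SimplexCategory.len_le_of_epi (SimplexCategory.δ i ≫ SimplexCategory.δ j.succ)
        simp at this
      obtain ⟨w, hw⟩ := exists_horn_filler (coΓ K) n x hxx
      have h₀ : ∀ i, (coΓ K).map (SimplexCategory.δ i) ≫
          (x 0 - (coΓ K).map (SimplexCategory.δ 0) ≫ w) = 0 := fun i => by
        have h₁ := hxx 0 i (Fin.zero_le _)
        have h₂ := SimplexCategory.δ_comp_δ (Fin.zero_le i)
        rw [Fin.castSucc_zero] at h₁ h₂
        rw [Preadditive.comp_sub, ← h₁, ← Category.assoc, ← (coΓ K).map_comp, ← h₂,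
          (coΓ K).map_comp, Category.assoc, hw, sub_self]
      have h₁ := eq_toNormalized_comp K n _ fun i => h₀ i.succ
      refine ⟨w, hw, h₁, fun m => ?_⟩
      by_cases hm : m = n
      · subst hm
        have h₂ := h₀ 0
        rw [← h₁, ← Category.assoc, δ_zero_toNormalized, Category.assoc] at h₂
        rw [← Category.id_comp ((K.d (m + 1) m).unop ≫ _), ← ofNormalized_toNormalized,
          Category.assoc, h₂, comp_zero]
      · rw [K.shape (n + 1) m (by simpa using hm), unop_zero, zero_comp]
  -- the positive faces of `v'` vanish
  have hv' : ∀ i : Fin (n + 1), (coΓ K).map (SimplexCategory.δ i.succ) ≫ (v - w ≫ p) = 0 :=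
      fun i => by
    rw [Preadditive.comp_sub, ← Category.assoc, hw, hxv, sub_self]
  have hv := eq_toNormalized_comp K n (v - w ≫ p) hv'
  obtain ⟨l, hl, hl'⟩ := hK n p ‹_› ‹_›
    (ofNormalized K n ≫ (x 0 - (coΓ K).map (SimplexCategory.δ 0) ≫ w))
    (ofNormalized K (n + 1) ≫ (v - w ≫ p)) hw₀ (by
      have h₁ : (x 0 - (coΓ K).map (SimplexCategory.δ 0) ≫ w) ≫ p =
          (coΓ K).map (SimplexCategory.δ 0) ≫ (v - w ≫ p) := by
        rw [Preadditive.sub_comp, Preadditive.comp_sub, hxv, Category.assoc]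
      rw [Category.assoc, h₁]
      conv_lhs => rw [← hv, ← Category.assoc ((coΓ K).map _), δ_zero_toNormalized,
        Category.assoc, reassoc_of% ofNormalized_toNormalized])
  have hl₀ : ∀ i, (coΓ K).map (SimplexCategory.δ i) ≫ (w + toNormalized K (n + 1) ≫ l) = x i := by
    intro i
    rw [Preadditive.comp_add, ← Category.assoc]
    obtain rfl | ⟨i, rfl⟩ := Fin.eq_zero_or_eq_succ i
    · rw [δ_zero_toNormalized, Category.assoc, hl, hx₀, add_sub_cancel]
    · rw [δ_succ_toNormalized, zero_comp, add_zero, hw]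
  refine ⟨w + toNormalized K (n + 1) ≫ l, ?_, fun c f hf hf' => ?_⟩
  · rw [Preadditive.add_comp, Category.assoc, hl', hv, add_sub_cancel]
  · obtain ⟨i, h, hfi⟩ := SimplexCategory.eq_comp_δ_of_not_surjective f
      (fun hs => hf' ((isIso_iff_surjective_of_mono f).2 hs))
    rw [← hcomp f hf hf' i h hfi, ← hl₀ i, ← Category.assoc, ← (coΓ K).map_comp, hfi]

end DoldKanReedy

/-! ### Resolution of a cofibrant object by cones -/

section Resolution

variable {C : Type u} [Category.{v} C] [Preadditive C] [ModelCategory C]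

/-- A cofibrant object `Q` embeds by a cofibration into a cone, i.e. into a cofibrant and weakly
contractible object `D`, and the cokernel `R` (the suspension of `Q`) is cofibrant again. That `D`
is cofibrant and weakly contractible is expressed by its lifting property against all
fibrations. -/
theorem exists_cone {Q : C} (hQ : IsCofibrant Q) :
    ∃ (D R : C) (j : Q ⟶ D) (π : D ⟶ R), Cofibration j ∧ IsCofibrant R ∧ Epi π ∧ j ≫ π = 0 ∧
      (∀ {E : C} (z : D ⟶ E), j ≫ z = 0 → ∃ z', π ≫ z' = z) ∧
      ∀ {E S : C} (p : E ⟶ S), Fibration p → ∀ y : D ⟶ S, ∃ l : D ⟶ E, l ≫ p = y := by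
  have : HasZeroObject C := hasZeroObject_of_hasTerminal_object
  let F := MorphismProperty.factorizationData (cofibrations C) (trivialFibrations C)
    (terminal.from Q)
  obtain ⟨D, j, q, hj, hq⟩ :
      ∃ (D : C) (j : Q ⟶ D) (q : D ⟶ ⊤_ C), Cofibration j ∧ WeakEquivalence q :=
    ⟨F.Z, F.i, F.p, ⟨F.hi⟩, ⟨F.hp.2⟩⟩
  refine ⟨D, cokernel j, j, cokernel.π j, hj, ?_, inferInstance, cokernel.condition j,
    fun z hz => ⟨cokernel.desc j z hz, cokernel.π_desc _ _ _⟩, fun {E S} p _ y => ?_⟩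
  · refine isCofibrant_of_exists_lift fun {E S} p _ _ y => ?_
    have sq : CommSq (0 : Q ⟶ E) j p (cokernel.π j ≫ y) := ⟨by simp⟩
    have : HasLiftingProperty j p := ModelCategory.cm4b _ _
    refine ⟨cokernel.desc _ sq.lift sq.fac_left, ?_⟩
    rw [← cancel_epi (cokernel.π j), ← Category.assoc, cokernel.π_desc, sq.fac_right]
  · have : IsIso (initial.to (⊤_ C)) :=
      ⟨0, initialIsInitial.hom_ext _ _, terminalIsTerminal.hom_ext _ _⟩
    have h₁ : initial.to D ≫ q = initial.to (⊤_ C) := initialIsInitial.hom_ext _ _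
    have : WeakEquivalence (initial.to (⊤_ C)) := inferInstance
    have : WeakEquivalence (initial.to D) := weakEquivalence_of_postcomp_of_fac h₁
    have : Cofibration (initial.to D) := by
      have := (isCofibrant_iff Q).1 hQ
      rw [show initial.to D = initial.to Q ≫ j from initialIsInitial.hom_ext _ _]
      infer_instance
    have sq : CommSq (initial.to E) (initial.to D) p y := ⟨initialIsInitial.hom_ext _ _⟩
    have : HasLiftingProperty (initial.to D) p := ModelCategory.cm4a _ _
    exact ⟨sq.lift, sq.fac_right⟩

/-- Splicing the cofiber sequences of `exists_cone` gives a cochain complex `K` with `K⁰ ≅ U` whose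
terms in positive degrees are cones: its differential factors through the epimorphisms `π` to the
iterated suspensions `Q` of `U` and the cofibrations `j` from these to their cones. -/
theorem exists_resolution_by_cones {U : C} (hU : IsCofibrant U) :
    ∃ (K : ChainComplex Cᵒᵖ ℕ) (Q : ℕ → C) (π : ∀ n, (K.X n).unop ⟶ Q n)
      (j : ∀ n, Q n ⟶ (K.X (n + 1)).unop),
      Nonempty ((K.X 0).unop ≅ U) ∧ (∀ n, (K.d (n + 1) n).unop = π n ≫ j n) ∧
      (∀ n, Cofibration (j n)) ∧ (∀ n, Epi (π n)) ∧
      (∀ {E : C} (z : (K.X 0).unop ⟶ E), ∃ z', π 0 ≫ z' = z) ∧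
      (∀ (n : ℕ) {E : C} (z : (K.X (n + 1)).unop ⟶ E), j n ≫ z = 0 → ∃ z', π (n + 1) ≫ z' = z) ∧
      ∀ (n : ℕ) {E S : C} (p : E ⟶ S), Fibration p → ∀ y : (K.X (n + 1)).unop ⟶ S,
        ∃ l : (K.X (n + 1)).unop ⟶ E, l ≫ p = y := by
  choose D R j π hj hR hπ hjπ hz hD using fun Q : {Q : C // IsCofibrant Q} => exists_cone Q.2
  let Q : ℕ → {Q : C // IsCofibrant Q} := fun n =>
    Nat.rec (motive := fun _ => {Q : C // IsCofibrant Q}) ⟨U, hU⟩ (fun _ Q => ⟨R Q, hR Q⟩) n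
  let N : ℕ → C := fun n => Nat.casesOn (motive := fun _ => C) n U fun n => D (Q n)
  let π' : ∀ n, N n ⟶ (Q n).1 := fun n =>
    Nat.casesOn (motive := fun n => N n ⟶ (Q n).1) n (𝟙 U) fun n => π (Q n)
  let j' : ∀ n, (Q n).1 ⟶ N (n + 1) := fun n => j (Q n)
  have hj' : ∀ n, j' n ≫ π' (n + 1) = 0 := fun n => hjπ (Q n)
  have hd : ∀ n, (π' n ≫ j' n) ≫ π' (n + 1) ≫ j' (n + 1) = 0 := fun n => by
    rw [Category.assoc, ← Category.assoc (j' n), hj', zero_comp, comp_zero]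
  refine ⟨ChainComplex.of (fun n => op (N n)) (fun n => (π' n ≫ j' n).op)
    (fun n => congrArg Quiver.Hom.op (hd n)), fun n => (Q n).1, π', j', ⟨Iso.refl U⟩,
    fun n => congrArg Quiver.Hom.unop (ChainComplex.of_d (fun n => op (N n))
      (fun n => (π' n ≫ j' n).op) n), fun n => hj (Q n), fun n => ?_,
    fun z => ⟨z, Category.id_comp z⟩, fun n _ z h => hz (Q n) z h,
    fun n _ _ p hp y => hD (Q n) p hp y⟩
  obtain _ | n := n
  · exact inferInstanceAs (Epi (𝟙 U))
  · exact hπ (Q n)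

end Resolution

/-! ### Cosimplicial resolutions of cofibrant objects -/

section Augmentation

open AlgebraicTopology AlgebraicTopology.DoldKan SimplicialObject

variable {C : Type u} [Category.{v} C] [Preadditive C]

theorem indexSet_eq_of_len_eq_zero {a : SimplexCategory} (B : Splitting.IndexSet (op a))
    (hB : B.1.unop.len = 0) (e : a ⟶ ⦋0⦌) [Epi e] : B = Splitting.IndexSet.mk e := by
  obtain ⟨⟨⟨k⟩⟩, α, hα⟩ := B
  obtain rfl : k = 0 := hB
  obtain rfl : α = e := SimplexCategory.isTerminalZero.hom_ext _ _
  rfl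

variable [ModelCategory C] (K : ChainComplex Cᵒᵖ ℕ)

/-- If all the summands but one of a direct sum have the left lifting property against all
fibrations, then the inclusion of the remaining summand is a trivial cofibration. -/
theorem trivialCofibration_summand {J : Type*} [Fintype J] [DecidableEq J] {Y : J → C} {X : C}
    (π : ∀ i, X ⟶ Y i) (ι : ∀ i, Y i ⟶ X) (h₁ : ∀ i, ι i ≫ π i = 𝟙 _)
    (h₂ : ∀ i i', i' ≠ i → ι i' ≫ π i = 0) (h₃ : 𝟙 X = ∑ i, π i ≫ ι i) (i₀ : J)
    (hY : ∀ i, i ≠ i₀ → ∀ {E S : C} (p : E ⟶ S), Fibration p → ∀ y : Y i ⟶ S,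
      ∃ l : Y i ⟶ E, l ≫ p = y) :
    Cofibration (ι i₀) ∧ WeakEquivalence (ι i₀) := by
  refine trivialCofibration_of_exists_lift _ fun {E S} p _ x y hxy => ?_
  have hl : ∀ i, ∃ l : Y i ⟶ E, l ≫ p = ι i ≫ y ∧ ι i₀ ≫ π i ≫ l = if i = i₀ then x else 0 := by
    intro i
    by_cases hi : i = i₀
    · subst hi
      exact ⟨x, hxy, by rw [if_pos rfl, ← Category.assoc, h₁, Category.id_comp]⟩
    · obtain ⟨l, hl⟩ := hY i hi p ‹_› (ι i ≫ y)
      exact ⟨l, hl, by rw [if_neg hi, ← Category.assoc, h₂ _ _ (Ne.symm hi), zero_comp]⟩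
  choose l hl hl' using hl
  refine ⟨∑ i, π i ≫ l i, ?_, ?_⟩
  · rw [Preadditive.comp_sum, Finset.sum_congr rfl fun i _ => hl' i]
    simp
  · rw [Preadditive.sum_comp, ← Category.id_comp y, h₃, Preadditive.sum_comp]
    exact Finset.sum_congr rfl fun i _ => by rw [Category.assoc, hl, Category.assoc]

/-- If the positive terms of a cochain complex are cofibrant and weakly contractible, then the
inclusion of the summand of `coΓ K` corresponding to the unique degeneracy on a vertex is a trivial
cofibration. It is a section of the projection to that summand. -/
theorem exists_section_coΓ
    (hK : ∀ (n : ℕ) {E S : C} (p : E ⟶ S), Fibration p → ∀ y : (K.X (n + 1)).unop ⟶ S,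
      ∃ l : (K.X (n + 1)).unop ⟶ E, l ≫ p = y)
    {a : SimplexCategory} (e : a ⟶ ⦋0⦌) :
    ∃ s : (K.X 0).unop ⟶ (coΓ K).obj a, s ≫ (coΓ K).map e ≫ toNormalized K 0 = 𝟙 _ ∧
      Cofibration s ∧ WeakEquivalence s := by
  classical
  have he : Epi e := SimplexCategory.epi_iff_surjective.2 fun y =>
    ⟨0, Subsingleton.elim (α := Fin 1) _ _⟩
  let S₀ := Γ₀.splitting K
  let B₀ : Splitting.IndexSet (op a) := Splitting.IndexSet.mk e
  let π : ∀ B : Splitting.IndexSet (op a), (coΓ K).obj a ⟶ (K.X B.1.unop.len).unop :=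
    fun B => ((S₀.cofan (op a)).inj B).unop
  let ι : ∀ B : Splitting.IndexSet (op a), (K.X B.1.unop.len).unop ⟶ (coΓ K).obj a :=
    fun B => (S₀.πSummand B).unop
  have hπ : (coΓ K).map e ≫ toNormalized K 0 = π B₀ :=
    Quiver.Hom.op_inj (Γ₀.Obj.map_epi_on_summand_id K e)
  have h₁ : ∀ B, ι B ≫ π B = 𝟙 _ := fun B => Quiver.Hom.op_inj (S₀.cofan_inj_πSummand_eq_id B)
  refine ⟨ι B₀, (congrArg (ι B₀ ≫ ·) hπ).trans (h₁ B₀),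
    trivialCofibration_summand π ι h₁ (fun B B' h =>
      Quiver.Hom.op_inj (S₀.cofan_inj_πSummand_eq_zero B B' h)) ?_ B₀ fun B hB => ?_⟩
  · refine Quiver.Hom.op_inj ((S₀.decomposition_id (op a)).trans ?_)
    rw [op_sum]
    rfl
  · obtain ⟨m, hm⟩ := Nat.exists_eq_succ_of_ne_zero
      (fun h => hB (indexSet_eq_of_len_eq_zero B h e))
    rw [hm]
    exact hK m

/-- In a model category with additive underlying category, any cofibrant object `U` has a
cosimplicial resolution, such that the augmentations to `U` have sections which are trivial
cofibrations. -/
theorem exists_cosimplicial_resolution {U : C} (hU : IsCofibrant U) :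
    ∃ (A : SimplexCategory ⥤ C) (α : ∀ a, A.obj a ⟶ U), IsReedyCofibrant (M := C) A ∧
      (∀ {a b : SimplexCategory} (f : a ⟶ b), A.map f ≫ α b = α a) ∧
      ∀ a, ∃ s : U ⟶ A.obj a, s ≫ α a = 𝟙 U ∧ Cofibration s ∧ WeakEquivalence s := by
  obtain ⟨K, Q, π, j, ⟨e⟩, hd, hj, hπ, hz₀, hz, hK⟩ := exists_resolution_by_cones hU
  refine ⟨coΓ K, fun a => ((coΓ K).map (SimplexCategory.isTerminalZero.from a) ≫
    toNormalized K 0) ≫ e.hom, isReedyCofibrant_coΓ K ?_ fun n {E S} p _ _ z y hzy hzy' => ?_,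
    fun {a b} f => ?_, fun a => ?_⟩
  · refine isCofibrant_of_exists_lift fun {E S} p _ _ y => ?_
    obtain ⟨l, hl⟩ := exists_lift_of_isCofibrant hU p (e.inv ≫ y)
    exact ⟨e.hom ≫ l, by rw [Category.assoc, hl, e.hom_inv_id_assoc]⟩
  · -- a cocycle on the `n`-th term is a map on the `n`-th suspension
    obtain ⟨z', rfl⟩ : ∃ z', π n ≫ z' = z := by
      obtain _ | n := n
      · exact hz₀ z
      · refine hz n z ?_
        have h := hzy n
        have := hπ n
        rwa [hd, Category.assoc, ← comp_zero (f := π n), cancel_epi] at h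
    have := hπ n
    have := hj n
    have sq : CommSq z' (j n) p y := ⟨by
      rwa [hd, Category.assoc, Category.assoc, cancel_epi] at hzy'⟩
    have : HasLiftingProperty (j n) p := ModelCategory.cm4b _ _
    exact ⟨sq.lift, by rw [hd, Category.assoc, sq.fac_left], sq.fac_right⟩
  · rw [← Category.assoc, ← Category.assoc, ← Functor.map_comp]
    congr 3
  · obtain ⟨s, hs, _, _⟩ := exists_section_coΓ K hK (SimplexCategory.isTerminalZero.from a)
    refine ⟨e.inv ≫ s, ?_, inferInstance, inferInstance⟩
    rw [← Category.assoc, Category.assoc e.inv, hs, Category.comp_id, e.inv_hom_id]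

end Augmentation

/-! ### Additive cosimplicial resolutions with levelwise augmentations -/

section LevelAugmentation

variable {M : Type u} [Category.{v} M] [ModelCategory M]

theorem isCosimplicialResolution_of_augmentation (X : SimplexCategory ⥤ M)
    (hX : IsReedyCofibrant (M := M) X) {Y : M} (ε : ∀ a, X.obj a ⟶ Y)
    (hε : ∀ {a b : SimplexCategory} (f : a ⟶ b), X.map f ≫ ε b = ε a)
    (hε' : ∀ a, WeakEquivalence (ε a)) : IsCosimplicialResolution (M := M) X := by
  have h {a b : SimplexCategory} (f : a ⟶ b) : WeakEquivalence (X.map f) :=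
    weakEquivalence_of_postcomp_of_fac (hε f)
  exact ⟨hX, fun _ _ => h _, fun _ _ => h _⟩

/-- A map `⦋n⦌ ⟶ ⦋0⦌` is a composition of codegeneracies. -/
theorem weakEquivalence_map_to_zero (X : SimplexCategory ⥤ M)
    (hX : IsCosimplicialResolution (M := M) X) (n : ℕ) (f : ⦋n⦌ ⟶ ⦋0⦌) :
    WeakEquivalence (X.map f) := by
  induction n with
  | zero =>
    obtain rfl : f = 𝟙 _ := SimplexCategory.isTerminalZero.hom_ext _ _
    rw [X.map_id]
    infer_instance
  | succ n ih =>
    obtain rfl : f = SimplexCategory.σ 0 ≫ SimplexCategory.isTerminalZero.from _ :=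
      SimplexCategory.isTerminalZero.hom_ext _ _
    have h₁ : WeakEquivalence (X.map (SimplexCategory.σ (0 : Fin (n + 1)))) :=
      hX.weakEquivalence_σ n 0
    have h₂ := ih (SimplexCategory.isTerminalZero.from _)
    rw [X.map_comp]
    infer_instance

namespace AdditiveCosimplicialResolution

variable [Preadditive M] {I : ObjectProperty M}

/-- An additive cosimplicial resolution, constructed from natural weak equivalences
`Γ(X)ⁿ ⟶ X` in all degrees. -/
noncomputable abbrev ofAugmentation (Γ : I.FullSubcategory ⥤ SimplexCategory ⥤ M)
    (hadd : ∀ {X Y : I.FullSubcategory} (f g : X ⟶ Y) (a : SimplexCategory),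
      (Γ.map (f + g)).app a = (Γ.map f).app a + (Γ.map g).app a)
    (hΓ : ∀ X, IsReedyCofibrant (M := M) (Γ.obj X)) (ε : ∀ X a, (Γ.obj X).obj a ⟶ X.obj)
    (hε : ∀ X {a b : SimplexCategory} (f : a ⟶ b), (Γ.obj X).map f ≫ ε X b = ε X a)
    (hε' : ∀ {X Y : I.FullSubcategory} (f : X ⟶ Y) (a : SimplexCategory),
      (Γ.map f).app a ≫ ε Y a = ε X a ≫ f.hom)
    (hε'' : ∀ X a, WeakEquivalence (ε X a)) : AdditiveCosimplicialResolution I where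
  Γ := Γ
  additive := ⟨NatTrans.ext (funext (hadd _ _))⟩
  isCosimplicialResolution X :=
    isCosimplicialResolution_of_augmentation (Γ.obj X) (hΓ X) (ε X) (hε X) (hε'' X)
  aug X := ε X ⦋0⦌
  aug_naturality f := hε' f ⦋0⦌
  weakEquivalence_aug X := hε'' X ⦋0⦌

variable (R : AdditiveCosimplicialResolution I)

/-- The functor underlying an additive cosimplicial resolution, with values in the category of
functors on `SimplexCategory`. -/
abbrev functor : I.FullSubcategory ⥤ SimplexCategory ⥤ M := R.Γ

theorem functor_map_add {X Y : I.FullSubcategory} (f g : X ⟶ Y) (a : SimplexCategory) :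
    (R.functor.map (f + g)).app a = (R.functor.map f).app a + (R.functor.map g).app a :=
  congrArg (fun φ : R.functor.obj X ⟶ R.functor.obj Y => φ.app a) (R.additive.map_add (f := f))

/-- The augmentation `Γ(X)ⁿ ⟶ X` of an additive cosimplicial resolution in an arbitrary degree. -/
noncomputable def levelAug (X : I.FullSubcategory) (a : SimplexCategory) :
    (R.functor.obj X).obj a ⟶ X.obj :=
  (R.functor.obj X).map (SimplexCategory.isTerminalZero.from a) ≫ R.aug X

theorem levelAug_zero (X : I.FullSubcategory) : R.levelAug X ⦋0⦌ = R.aug X := by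
  have h : SimplexCategory.isTerminalZero.from ⦋0⦌ = 𝟙 _ :=
    SimplexCategory.isTerminalZero.hom_ext _ _
  rw [levelAug, h, CategoryTheory.Functor.map_id]
  exact Category.id_comp _

theorem map_levelAug (X : I.FullSubcategory) {a b : SimplexCategory} (f : a ⟶ b) :
    (R.functor.obj X).map f ≫ R.levelAug X b = R.levelAug X a := by
  rw [levelAug, ← Category.assoc, ← Functor.map_comp]
  congr 2

theorem levelAug_naturality {X Y : I.FullSubcategory} (f : X ⟶ Y) (a : SimplexCategory) :
    (R.functor.map f).app a ≫ R.levelAug Y a = R.levelAug X a ≫ f.hom := by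
  rw [levelAug, levelAug, Category.assoc, ← R.aug_naturality f, ← Category.assoc,
    ← NatTrans.naturality, Category.assoc]

theorem weakEquivalence_levelAug (X : I.FullSubcategory) (a : SimplexCategory) :
    WeakEquivalence (R.levelAug X a) := by
  have h₁ : WeakEquivalence ((R.functor.obj X).map (SimplexCategory.isTerminalZero.from a)) :=
    weakEquivalence_map_to_zero _ (R.isCosimplicialResolution X) a.len _
  have h₂ := R.weakEquivalence_aug X
  exact inferInstanceAs (WeakEquivalence (_ ≫ _))

end AdditiveCosimplicialResolution

end LevelAugmentation

/-! ### Tensoring with a cosimplicial resolution of the unit -/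

/-- A functor which preserves finite colimits between additive categories is additive. -/
theorem map_add_app {C : Type u₁} [Category.{v₁} C] {M : Type u₂} [Category.{v₂} M]
    [HasFiniteCoproducts M] [HasTerminal M] [Preadditive M] {T : M ⥤ C ⥤ M}
    (hT : ∀ Y, PreservesFiniteColimits (T.flip.obj Y)) {X Y : M}
    (f g : X ⟶ Y) (c : C) : (T.map (f + g)).app c = (T.map f).app c + (T.map g).app c := by
  have : HasZeroObject M := hasZeroObject_of_hasTerminal_object
  have : HasBinaryBiproducts M := HasBinaryBiproducts.of_hasBinaryCoproducts
  have : (T.flip.obj c).PreservesZeroMorphisms :=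
    Functor.preservesZeroMorphisms_of_preserves_initial_object
  have := preservesBinaryBiproducts_of_preservesBinaryCoproducts (T.flip.obj c)
  have := Functor.additive_of_preservesBinaryBiproducts (T.flip.obj c)
  exact (T.flip.obj c).map_add

section Tensor

open AdditiveCosimplicialResolution

variable {C : Type u₁} [Category.{v₁} C] [ModelCategory C] {M : Type u₂} [Category.{v₂} M]
  [ModelCategory M] [Preadditive M] {T : M ⥤ C ⥤ M}

/-- A natural transformation `P ⟶ P'` induces a natural transformation between diagonals. -/
abbrev diagonalMap (T : M ⥤ C ⥤ M) {P P' : SimplexCategory ⥤ M} (φ : P ⟶ P')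
    (A : SimplexCategory ⥤ C) : diagonal T P A ⟶ diagonal T P' A where
  app a := bimap T (φ.app a) (𝟙 _)
  naturality a b f := by
    rw [diagonal_map, diagonal_map, bimap_comp, bimap_comp, φ.naturality, Category.comp_id,
      Category.id_comp]

/-- If `A` is a cosimplicial resolution of the unit, then the objects `T(X, Aⁿ)` form an additive
cosimplicial resolution, and any additive cosimplicial resolution `Γ` is connected to it by the
natural weak equivalences `Γ(X)ⁿ ← T(Γ(X)ⁿ, Aⁿ) → T(X, Aⁿ)`. -/
theorem isConnected_additiveCosimplicialResolution
    [∀ X, PreservesFiniteColimits (T.obj X)] [∀ Y, PreservesFiniteColimits (T.flip.obj Y)]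
    (hT : PushoutProductAxiom T)
    (hadd : ∀ {X Y : M} (f g : X ⟶ Y) (c : C),
      (T.map (f + g)).app c = (T.map f).app c + (T.map g).app c)
    (A : SimplexCategory ⥤ C) (hA : IsReedyCofibrant (M := C) A)
    (ε : ∀ X a, (T.obj X).obj (A.obj a) ⟶ X)
    (hε : ∀ X {a b : SimplexCategory} (f : a ⟶ b), (T.obj X).map (A.map f) ≫ ε X b = ε X a)
    (hε' : ∀ {X Y : M} (f : X ⟶ Y) a, (T.map f).app (A.obj a) ≫ ε Y a = ε X a ≫ f)
    (hε'' : ∀ X, IsCofibrant X → ∀ a, WeakEquivalence (ε X a))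
    (I : ObjectProperty M) (hI : I ≤ cofibrantObjects M) :
    IsConnected (AdditiveCosimplicialResolution I) := by
  -- the resolution by the objects `T(X, Aⁿ)`
  let E : AdditiveCosimplicialResolution I := ofAugmentation
    { obj X := A ⋙ T.obj X.obj
      map f := A.whiskerLeft (T.map f.hom) }
    (fun f g a => hadd f.hom g.hom (A.obj a))
    (fun X => isReedyCofibrant_comp_obj hT (hI _ X.2) A hA)
    (fun X => ε X.obj) (fun X => hε X.obj) (fun f => hε' f.hom) (fun X => hε'' X.obj (hI _ X.2))
  have hR (R : AdditiveCosimplicialResolution I) : Zigzag R E := by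
    have hRA (X : I.FullSubcategory) (a : SimplexCategory) :
        WeakEquivalence (ε ((R.functor.obj X).obj a) a) :=
      hε'' _ (isCofibrant_of_isReedyCofibrant _ (R.isCosimplicialResolution X).reedyCofibrant a) a
    have hε₂ {X Y : M} (f : X ⟶ Y) {a b : SimplexCategory} (g : a ⟶ b) :
        bimap T f (A.map g) ≫ ε Y b = ε X a ≫ f := by
      rw [← Category.id_comp (A.map g), ← Category.comp_id f, ← bimap_comp, bimap_id_left,
        bimap_id_right, Category.assoc, hε, hε', Category.comp_id]
    have hε₃ {X Y : M} (f : X ⟶ Y) (a : SimplexCategory) :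
        bimap T f (𝟙 (A.obj a)) ≫ ε Y a = ε X a ≫ f := by
      rw [bimap_id_right, hε']
    have hDE (X : I.FullSubcategory) (a : SimplexCategory) :
        WeakEquivalence (ε ((R.functor.obj X).obj a) a ≫ R.levelAug X a) := by
      have := hRA X a
      have := R.weakEquivalence_levelAug X a
      infer_instance
    -- the resolution by the objects `T(Γ(X)ⁿ, Aⁿ)`
    let D : AdditiveCosimplicialResolution I := ofAugmentation
      { obj X := diagonal T (R.functor.obj X) A
        map f := diagonalMap T (R.functor.map f) A
        map_id X := by
          ext a
          simp [bimap_id]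
        map_comp f g := by
          ext a
          simp [bimap_comp] }
      (fun f g a => by
        dsimp only [diagonalMap]
        rw [R.functor_map_add, bimap_id_right, bimap_id_right, bimap_id_right, hadd])
      (fun X => isReedyCofibrant_diagonal hT _ A
        (R.isCosimplicialResolution X).reedyCofibrant hA)
      (fun X a => ε _ a ≫ R.levelAug X a)
      (fun X a b f => by rw [diagonal_map, ← Category.assoc, hε₂, Category.assoc, R.map_levelAug])
      (fun f a => by
        rw [← Category.assoc, hε₃, Category.assoc, Category.assoc, R.levelAug_naturality])
      hDE
    let f : D ⟶ R :=
      { τ := { app X := ({ app a := ε _ a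
                           naturality a b f := hε₂ _ _ } :
                diagonal T (R.functor.obj X) A ⟶ R.functor.obj X)
               naturality X Y f := NatTrans.ext (funext fun a => hε₃ _ a) }
        τ_aug X := congrArg (ε _ ⦋0⦌ ≫ ·) (R.levelAug_zero X).symm
        weakEquivalence_τ := hRA }
    let g : D ⟶ E :=
      { τ := { app X := ({ app a := bimap T (R.levelAug X a) (𝟙 _)
                           naturality a b f := by
                            rw [diagonal_map, bimap_comp, R.map_levelAug, Functor.comp_map,
                              ← bimap_id_left, bimap_comp, Category.comp_id, Category.comp_id,
                              Category.id_comp] } :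
                diagonal T (R.functor.obj X) A ⟶ A ⋙ T.obj X.obj)
               naturality X Y f := NatTrans.ext (funext fun a => by
                 have h : bimap T ((R.functor.map f).app a) (𝟙 _) ≫
                     bimap T (R.levelAug Y a) (𝟙 _) =
                       bimap T (R.levelAug X a) (𝟙 (A.obj a)) ≫ (T.map f.hom).app (A.obj a) := by
                   rw [← bimap_id_right T, bimap_comp, bimap_comp, R.levelAug_naturality]
                 exact h) }
        τ_aug X := hε₃ _ _
        weakEquivalence_τ X a := by
          have := hDE X a
          have := hε'' X.obj (hI _ X.2) a
          exact weakEquivalence_of_postcomp_of_fac (hε₃ (R.levelAug X a) a) }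
    exact Zigzag.of_inv_hom f g
  have : Nonempty (AdditiveCosimplicialResolution I) := ⟨E⟩
  exact zigzag_isConnected fun R S => (hR R).trans (hR S).symm

/-- Let `T` be a bifunctor satisfying the pushout-product axiom and preserving finite colimits in
each variable. If `T(-, U)` is isomorphic to the identity functor for some cofibrant object `U`,
then the model structure on `M` is additive. -/
theorem isAdditiveModelCategory_of_pushoutProduct [Preadditive C]
    (hT : PushoutProductAxiom T) (h₁ : ∀ X, PreservesFiniteColimits (T.obj X))
    (h₂ : ∀ Y, PreservesFiniteColimits (T.flip.obj Y)) {U : C} (hU : IsCofibrant U)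
    (ρ : ∀ X, (T.obj X).obj U ≅ X)
    (hρ : ∀ {X Y : M} (f : X ⟶ Y), (T.map f).app U ≫ (ρ Y).hom = (ρ X).hom ≫ f) :
    IsAdditiveModelCategory M := by
  obtain ⟨A, α, hA, hα, hs⟩ := exists_cosimplicial_resolution hU
  have h (I : ObjectProperty M) (hI : I ≤ cofibrantObjects M) :
      IsConnected (AdditiveCosimplicialResolution I) := by
    refine isConnected_additiveCosimplicialResolution hT (map_add_app h₂) A hA
      (fun X a => (T.obj X).map (α a) ≫ (ρ X).hom) (fun X a b f => ?_) (fun {X Y} f a => ?_)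
      (fun X hX a => ?_) I hI
    · rw [← Category.assoc, ← Functor.map_comp, hα]
    · rw [Category.assoc, ← hρ, NatTrans.naturality_assoc]
    · obtain ⟨s, hs, hs₁, hs₂⟩ := hs a
      have := weakEquivalence_obj_map hT hX s hs₁ hs₂
      -- `T(X, α)` has a section which is a trivial cofibration
      have : WeakEquivalence ((T.obj X).map (α a)) := by
        have h : (T.obj X).map s ≫ (T.obj X).map (α a) = 𝟙 _ := by
          rw [← Functor.map_comp, hs, CategoryTheory.Functor.map_id]
        have : WeakEquivalence ((T.obj X).map s ≫ (T.obj X).map (α a)) := by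
          rw [h]
          infer_instance
        exact weakEquivalence_of_precomp ((T.obj X).map s) _
      infer_instance
  exact ⟨inferInstance, inferInstance, fun I _ hI => ⟨(h I hI).is_nonempty, h I hI⟩⟩

end Tensor

/-! ### Additivity of the underlying category of a closed module category -/

section Preadditive

variable {C : Type u₁} [Category.{v₁} C] {M : Type u₂} [Category.{v₂} M]

/-- The addition of `C` on `Hom(U, H(X, Z)) ≃ Hom(X, Z)` makes `M` preadditive. -/
theorem nonempty_preadditive_of_homEquiv [Preadditive C] (H : Mᵒᵖ ⥤ M ⥤ C) (U : C)
    (e : ∀ X Z : M, (X ⟶ Z) ≃ (U ⟶ (H.obj (op X)).obj Z))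
    (he : ∀ {X Z Z' : M} (f : X ⟶ Z) (g : Z ⟶ Z'), e X Z' (f ≫ g) = e X Z f ≫ (H.obj _).map g)
    (he' : ∀ {X X' Z : M} (f : X ⟶ X') (g : X' ⟶ Z),
      e X Z (f ≫ g) = e X' Z g ≫ (H.map f.op).app Z) :
    Nonempty (Preadditive M) := by
  let h (X Z : M) : AddCommGroup (X ⟶ Z) := (e X Z).addCommGroup
  have hadd (X Z : M) (f g : X ⟶ Z) : e X Z (f + g) = e X Z f + e X Z g :=
    (e X Z).apply_symm_apply _
  refine ⟨{ homGroup := h, add_comp := fun X Y Z f f' g => (e X Z).injective ?_,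
            comp_add := fun X Y Z f g g' => (e X Z).injective ?_ }⟩
  · rw [hadd, he, he, he, hadd, Preadditive.add_comp]
  · rw [hadd, he', he', he', hadd, Preadditive.add_comp]

/-- If `T(X, U) ≅ X` and if `T(X, -)` has a right adjoint `H(X, -)`, then `Hom(X, Z)` is in
bijection with `Hom(U, H(X, Z))`. -/
theorem nonempty_preadditive_of_parametrizedAdjunction [Preadditive C] {T : M ⥤ C ⥤ M}
    {H : Mᵒᵖ ⥤ M ⥤ C} (adj : T ⊣₂ H) {U : C} (ρ : ∀ X, (T.obj X).obj U ≅ X)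
    (hρ : ∀ {X Y : M} (f : X ⟶ Y), (T.map f).app U ≫ (ρ Y).hom = (ρ X).hom ≫ f) :
    Nonempty (Preadditive M) := by
  refine nonempty_preadditive_of_homEquiv H U
    (fun X Z => ((ρ X).symm.homCongr (Iso.refl Z)).trans adj.homEquiv) (fun f g => ?_)
    fun f g => ?_
  · simp [← adj.homEquiv_naturality_three]
  · simp [← adj.homEquiv_naturality_one, reassoc_of% hρ]

end Preadditive

end AdditiveModel

theorem mainTheorem11 {C : Type u₁} [Category.{v₁} C] [ModelCategory C]
    [MonoidalCategory C] [SymmetricCategory C] [MonoidalClosed C]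
    [AdditiveModel.IsSymmetricMonoidalModelCategory C]
    (hunit : IsCofibrant (𝟙_ C)) (hadd : AdditiveModel.IsAdditiveCategory C) :
    AdditiveModel.IsAdditiveModelCategory C ∧
      ∀ (M : Type u₂) [Category.{v₂} M] [ModelCategory M]
        [AdditiveModel.ClosedModuleCategory C M] [AdditiveModel.IsCModelCategory C M],
        AdditiveModel.IsAdditiveModelCategory M := by
  obtain ⟨_⟩ := hadd.nonempty_preadditive
  refine ⟨?_, fun M _ _ _ _ => ?_⟩
  · have h (X : C) : PreservesFiniteColimits (tensorLeft X) := by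
      have := (ihom.adjunction X).leftAdjoint_preservesColimits
      infer_instance
    exact AdditiveModel.isAdditiveModelCategory_of_pushoutProduct
      (AdditiveModel.IsSymmetricMonoidalModelCategory.pushoutProduct (C := C)) h
      (fun Y => preservesFiniteColimits_of_natIso (BraidedCategory.tensorLeftIsoTensorRight Y))
      hunit (fun X => ρ_ X) (fun f => rightUnitor_naturality f)
  · have h₁ (X : M) : PreservesFiniteColimits
        ((MonoidalRightAction.curriedAction C M).flip.obj X) := by
      have := (AdditiveModel.ClosedModuleCategory.tensorHomAdj (C := C) (M := M)).adj X
        |>.leftAdjoint_preservesColimits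
      infer_instance
    have h₂ (c : C) : PreservesFiniteColimits
        ((MonoidalRightAction.curriedAction C M).flip.flip.obj c) := by
      have := (AdditiveModel.ClosedModuleCategory.tensorCotensorAdj (C := C) (M := M)).adj c
        |>.leftAdjoint_preservesColimits
      exact inferInstanceAs
        (PreservesFiniteColimits ((MonoidalRightAction.curriedAction C M).obj c))
    obtain ⟨_⟩ := AdditiveModel.nonempty_preadditive_of_parametrizedAdjunction
      (AdditiveModel.ClosedModuleCategory.tensorHomAdj (C := C) (M := M))
      (fun X => MonoidalRightActionStruct.actionUnitIso (C := C) X)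
      (fun f => (MonoidalRightAction.actionUnitIso_hom_naturality f).symm)
    exact AdditiveModel.isAdditiveModelCategory_of_pushoutProduct
      (AdditiveModel.IsCModelCategory.pushoutProduct (C := C) (M := M)) h₁ h₂ hunit
      (fun X => MonoidalRightActionStruct.actionUnitIso (C := C) X)
      (fun f => (MonoidalRightAction.actionUnitIso_hom_naturality f).symm)
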